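/- Words are infinite words over \(\{0,1\}\), ordered lexicographically; \(O(\mathbf u)=\{u_ku_{k+1}\cdots : k\ge 1\}\) is the shift orbit of \(\mathbf u=u_1u_2\cdots\), \(\bar a=aaa\cdots\), and \(\pi_\beta(u_1u_2\cdots)=\sum_{k\ge1}u_k\beta^{-k}\) for a digit sequence \(u_1u_2\cdots\). For \(m\in(1,2]\) and \(\beta>1\), let \(U_\beta(m)\) be the set of \(\mathbf u\in\{0,1,m\}^\infty\) with \(\pi_\beta(\mathbf u)\ne\pi_\beta(\mathbf v)\) for all \(\mathbf v\in\{0,1,m\}^\infty\setminus\{\mathbf u\}\), and let \[\mathcal L(m)=\inf\{\beta>1 : U_\beta(m)\cap\{0,1\}^\infty\text{ is uncountable}\}.\] For a word \(\mathbf u\) and \(m\in(1,2]\), let \(g_{\mathbf u}(m)\) be the unique positive solution \(x\) of \((x-1)(1+\pi_x(\inf O(\mathbf u)))=m\) and, if \(\mathbf u\) contains at least two ones, let \(f_{\mathbf u}(m)\) be the unique positive solution \(x\) of \(x\,\pi_x(\sup O(\mathbf u))=m\), and let \(\mu_{\mathbf u}\) be the unique number in \((1,2]\) with \(f_{\mathbf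 u}(\mu_{\mathbf u})=g_{\mathbf u}(\mu_{\mathbf u})\) (all these are well defined). Let \(L,M,R\) be the substitutions \(L:0\mapsto0,\,1\mapsto01\); \(M:0\mapsto01,\,1\mapsto10\); \(R:0\mapsto01,\,1\mapsto1\), acting on finite and infinite words, and let \(\{L,M,R\}^*\) be the monoid that they generate. Let \(\mathcal S_{\{L,M,R\}}\) be the set of words \(\mathbf u\) for which there are a sequence \((\sigma_n)_{n\ge1}\) in \(\{L,M,R\}\) and words \(\mathbf u^{(n)}\) with \(\mathbf u^{(1)}=\mathbf u\) and \(\mathbf u^{(n)}=\sigma_n(\mathbf u^{(n+1)})\) for all \(n\ge1\), such that for each \(k\ge1\) there is \(n\ge k\) for which both \(\sigma_k\cdots\sigma_n(0)\) and \(\sigma_k\cdots\sigma_n(1)\) contain both letters. **Theorem.** For \(1<m\le2\), \[ \mathcal L(m)=\begin{cases} g_{\sigma(1\bar0)}(m) & \text{if } m\in[\mu_{\sigma(1\bar0)},\mu_{\sigma(01\bar0)}],\ \sigma\in\{L,M,R\}^*M,\\ f_{\sigma(0\bar1)}(m) & \text{if } m\in[\mu_{\sigma(10\bar1)},\mu_{\sigma(0\bar1)}],\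 \sigma\in\{L,M,R\}^*M,\\ g_{0\bar1}(m) & \text{if } m\in[\mu_{0\bar1},2],\\ f_{\mathbf u}(m) & \text{if } m=\mu_{\mathbf u},\ \mathbf u\in\mathcal S_{\{L,M,R\}}, \end{cases} \] and every \(m\in(1,2]\) belongs to at least one of these cases. Moreover, for every \(m\in(1,2]\) and every \(\beta>\mathcal L(m)\), the Hausdorff dimension of \(\pi_\beta(U_\beta(m))\) is positive. -/

import Mathlib

namespace TMS

/-! ### Expansions in real bases and unique expansions -/

/-- The value `∑_{k ≥ 1} u_k / β ^ k` of a digit sequence (sequences are indexed from `0`). -/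
noncomputable def val (β : ℝ) (u : ℕ → ℝ) : ℝ := ∑' k : ℕ, u k / β ^ (k + 1)

/-- The sequences with all digits in the alphabet `A`. -/
def seqs (A : Set ℝ) : Set (ℕ → ℝ) := {u | ∀ k, u k ∈ A}

/-- The unique `β`-expansions over the alphabet `A`. -/
def uniqueExp (β : ℝ) (A : Set ℝ) : Set (ℕ → ℝ) :=
  {u | u ∈ seqs A ∧ ∀ v ∈ seqs A, v ≠ u → val β u ≠ val β v}

/-- The critical base: the infimum of the bases `β > 1` for which uncountably many
unique `β`-expansions over `{0, 1, m}` use only the digits `0` and `1`. -/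
noncomputable def critBase (m : ℝ) : ℝ :=
  sInf {β : ℝ | 1 < β ∧ ¬ (uniqueExp β {0, 1, m} ∩ seqs {0, 1}).Countable}

/-! ### Infinite words over `{0, 1}` and the lexicographic order -/

/-- Infinite words over `{0, 1}`. -/
abbrev Word : Type := ℕ → Fin 2

/-- The word `w a a a ⋯`, for a finite word `w` and a letter `a`. -/
def evConst (w : List (Fin 2)) (a : Fin 2) : Word := fun k => w.getD k a

/-- The value of a `0`-`1`-word in base `β`. -/
noncomputable def wval (β : ℝ) (u : Word) : ℝ := val β fun k => ((u k : ℕ) : ℝ)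

/-- The shift orbit of `u`, inside the words with the lexicographic order. -/
def orbit (u : Word) : Set (Lex (ℕ → Fin 2)) :=
  Set.range fun n : ℕ => toLex fun k => u (k + n)

/-- The lexicographic supremum of the shift orbit. -/
noncomputable def supO (u : Word) : Word := ofLex (sSup (orbit u))

/-- The lexicographic infimum of the shift orbit. -/
noncomputable def infO (u : Word) : Word := ofLex (sInf (orbit u))

/-! ### The functions `f_u`, `g_u` and the numbers `μ_u` -/

/-- `x` is a positive solution of the equation that defines `f_u(m)`. -/
def IsF (u : Word) (m x : ℝ) : Prop := 0 < x ∧ x * wval x (supO u) = m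

/-- `x` is a positive solution of the equation that defines `g_u(m)`. -/
def IsG (u : Word) (m x : ℝ) : Prop := 0 < x ∧ (x - 1) * (1 + wval x (infO u)) = m

/-- `f_u(m)`, the positive `x` with `x π_x(sup O(u)) = m`. -/
noncomputable def f (u : Word) (m : ℝ) : ℝ := Classical.epsilon (IsF u m)

/-- `g_u(m)`, the positive `x` with `(x - 1) (1 + π_x(inf O(u))) = m`. -/
noncomputable def g (u : Word) (m : ℝ) : ℝ := Classical.epsilon (IsG u m)

/-- `m ∈ (1, 2]` is a solution of `f_u(m) = g_u(m)`. -/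
def IsMu (u : Word) (m : ℝ) : Prop := (1 < m ∧ m ≤ 2) ∧ f u m = g u m

/-- `μ_u`, the number in `(1, 2]` with `f_u(μ_u) = g_u(μ_u)`. -/
noncomputable def mu (u : Word) : ℝ := Classical.epsilon (IsMu u)

/-- The word `u` contains at least two ones. -/
def TwoOnes (u : Word) : Prop := ∃ i j : ℕ, i ≠ j ∧ u i = 1 ∧ u j = 1

/-! ### Substitutions -/

/-- The names of the three substitutions. -/
inductive Gen : Type
  | L
  | M
  | R

/-- The images of the two letters under `L`, `M` and `R`. -/
def Gen.letter : Gen → Fin 2 → List (Fin 2)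
  | .L, 0 => [0]
  | .L, 1 => [0, 1]
  | .M, 0 => [0, 1]
  | .M, 1 => [1, 0]
  | .R, 0 => [0, 1]
  | .R, 1 => [1]

/-- The action of `L`, `M`, `R` on finite words. -/
def Gen.onList (s : Gen) (w : List (Fin 2)) : List (Fin 2) := w.flatMap s.letter

/-- The action of `L`, `M`, `R` on infinite words. As no letter is erased, the image of the
prefix of length `k + 1` has a letter at position `k`, and this is the letter of the image. -/
def Gen.onWord (s : Gen) (u : Word) : Word :=
  fun k => (s.onList ((List.range (k + 1)).map u)).getD k 0

/-- The action on finite words of the product `s₁ s₂ ⋯ sₙ` of substitutions (`s₁` is applied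
last). The products of all finite lists form the monoid generated by `L`, `M`, `R`. -/
def listOnList (σ : List Gen) (w : List (Fin 2)) : List (Fin 2) := σ.foldr Gen.onList w

/-- The action on infinite words of the product `s₁ s₂ ⋯ sₙ` of substitutions. -/
def listOnWord (σ : List Gen) (u : Word) : Word := σ.foldr Gen.onWord u

/-- `u` is a limit word of the sequence `s` of substitutions. -/
def IsLimitWord (s : ℕ → Gen) (u : Word) : Prop :=
  ∃ v : ℕ → Word, v 0 = u ∧ ∀ n, v n = (s n).onWord (v (n + 1))

/-- Primitivity: for each `k` there is `n ≥ k` such that the images of both letters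
under `s_k s_{k+1} ⋯ s_n` contain both letters. -/
def IsPrimitive (s : ℕ → Gen) : Prop :=
  ∀ k, ∃ n, k ≤ n ∧ ∀ a b : Fin 2,
    b ∈ listOnList ((List.range' k (n + 1 - k)).map s) [a]

/-- The Thue–Morse–Sturmian words: limit words of primitive sequences in `{L, M, R}`. -/
def tmsWords : Set Word := {u | ∃ s : ℕ → Gen, IsPrimitive s ∧ IsLimitWord s u}

end TMS

/-!
Let `H x a = (x - 1) (1 + π_x(a))` and `F x b = x π_x(b)`, so that `g_u` and `f_u` solve
`H x (inf O(u)) = m` and `F x (sup O(u)) = m`. In a base `β > 2`, a word over `{0, 1}`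
all of whose tails `t` satisfy `H β t > m` and `F β t < m` is a unique expansion over `{0, 1, m}`
(`dig_mem_uniqueExp`); for `β ≤ 1 + m`, conversely, what follows the first letter `1`
in a unique expansion over `{0, 1}` has these properties (`eventually_admissible`). In bases
`β ≤ 2`, at most the zero word is a unique expansion over `{0, 1}`. Since values in base `β ≥ 2` are monotone for the
lexicographic order, everything depends on the words whose tails lie in a lexicographic
interval `[a, b]`.

The substitutions act on such intervals. If all tails of `v` lie in `[a, b]`, then all tails of
`s v` lie in `[lo s a, hi s b]` (`Within.onWord`), and conversely a word whose tails lie in the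
open interval `(lo s a, hi s b)` is, up to a finite prefix and up to images of constant words, the
image under `s` of a word with tails in `(a, b)` (`countable_inside_step`). Hence only countably
many words are inside the image of `(000⋯, 1000⋯)` under a product of substitutions
(`countable_inside`). On the other hand, the maps `lo s` and `hi s` lengthen common prefixes, thus
the images of all pairs of words that begin with `0` and `1` are close to each other when the
product is long. If `(a, b)` is a limit of such images (`Approx`), then the tails of `σ M(w)` are
almost in `[a, b]` for a suitable `σ` and all words `w`. So at most countably many words are
admissible below the curves of `a` and `b` (`countable_admissible`), and above these curves the
admissible words contain all concatenations of two different blocks of the same length, which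
gives positive dimension (`dimH_pos_of_approx`). This determines the critical base whenever the
curves of one or two such pairs are comparable, see `critBase_eq_of_common_lo` and
`critBase_eq_of_common_hi`.

The relevant pairs are the images of `(000⋯, 1000⋯)` and `(0111⋯, 111⋯)`, which are fixed by `L`
and by `R`, and the pairs of the limit words. To a product `σ` belongs the interval between the
numbers `μ` of `σ(010⋯)` and `σ(101⋯)`, and this interval is the union of the intervals of
`σL`, `σM`, `σR` and of the two plateaus of `σM` (`IsNode.exists_child`). If `m` is in none of
the plateaus, then an infinite sequence of nested intervals contains `m`, and by continuity
`m = μ_u` for a limit word `u` of the sequence if the latter is primitive, while sequences that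
end with `LLL⋯` or `RRR⋯` lead to ends of plateaus (`cover`).
-/

open Filter Topology

namespace TMS

/-! ### Words, prefixes and the lexicographic order -/

/-- The word `a w`. -/
def cons (a : Fin 2) (w : Word) : Word
  | 0 => a
  | k + 1 => w k

/-- The word `u` without its first `n` letters. -/
def drop (n : ℕ) (u : Word) : Word := fun k => u (k + n)

/-- The constant word `a a a ⋯`. -/
def const (a : Fin 2) : Word := fun _ => a

/-- `u` and `v` have the same prefix of length `N`. -/
def Agree (N : ℕ) (u v : Word) : Prop := ∀ i < N, u i = v i

/-- The lexicographic order, strict version. -/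
abbrev LexLt (u v : Word) : Prop := toLex u < toLex v

/-- The lexicographic order. -/
abbrev LexLe (u v : Word) : Prop := toLex u ≤ toLex v

infix:50 " ≺ " => LexLt

infix:50 " ≼ " => LexLe

@[simp] theorem cons_zero (a : Fin 2) (w : Word) : cons a w 0 = a := rfl

@[simp] theorem cons_succ (a : Fin 2) (w : Word) (k : ℕ) : cons a w (k + 1) = w k := rfl

@[simp] theorem drop_apply (n : ℕ) (u : Word) (k : ℕ) : drop n u k = u (k + n) := rfl

@[simp] theorem const_apply (a : Fin 2) (k : ℕ) : const a k = a := rfl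

@[simp] theorem drop_zero (u : Word) : drop 0 u = u := rfl

theorem drop_drop (n k : ℕ) (u : Word) : drop n (drop k u) = drop (n + k) u := by
  funext i; simp [add_assoc]

@[simp] theorem drop_succ_cons (n : ℕ) (a : Fin 2) (w : Word) :
    drop (n + 1) (cons a w) = drop n w := rfl

theorem drop_one_cons (a : Fin 2) (w : Word) : drop 1 (cons a w) = w := rfl

theorem cons_drop (u : Word) (n : ℕ) : cons (u n) (drop (n + 1) u) = drop n u := by
  funext k
  cases k with
  | zero => simp
  | succ k => simp [add_comm, add_left_comm]

theorem cons_drop_one (u : Word) : cons (u 0) (drop 1 u) = u := cons_drop u 0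

theorem cons_const (a : Fin 2) : cons a (const a) = const a := by
  funext k; cases k <;> rfl

@[simp] theorem drop_const (n : ℕ) (a : Fin 2) : drop n (const a) = const a := rfl

theorem fin2_cases (a : Fin 2) : a = 0 ∨ a = 1 := by omega

theorem Agree.mono {N K : ℕ} {u v : Word} (h : Agree N u v) (hK : K ≤ N) : Agree K u v :=
  fun i hi => h i (by omega)

theorem Agree.symm {N : ℕ} {u v : Word} (h : Agree N u v) : Agree N v u :=
  fun i hi => (h i hi).symm

theorem Agree.trans {N : ℕ} {u v w : Word} (h : Agree N u v) (h' : Agree N v w) :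
    Agree N u w :=
  fun i hi => (h i hi).trans (h' i hi)

theorem agree_zero (u v : Word) : Agree 0 u v := fun i hi => by omega

theorem agree_one {u v : Word} (h : u 0 = v 0) : Agree 1 u v := fun i hi => by
  obtain rfl : i = 0 := by omega
  exact h

theorem agree_cons_iff {N : ℕ} {a : Fin 2} {u v : Word} :
    Agree (N + 1) (cons a u) (cons a v) ↔ Agree N u v := by
  constructor
  · intro h i hi
    simpa using h (i + 1) (by omega)
  · rintro h (_ | i) hi
    · rfl
    · simpa using h i (by omega)

theorem Agree.cons {N : ℕ} {u v : Word} (h : Agree N u v) (a : Fin 2) :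
    Agree N (cons a u) (cons a v) :=
  (agree_cons_iff.2 h).mono (Nat.le_succ N)

theorem lexLt_iff {u v : Word} : u ≺ v ↔ ∃ k, Agree k u v ∧ u k = 0 ∧ v k = 1 := by
  constructor
  · rintro ⟨k, h, hk⟩
    refine ⟨k, h, ?_⟩
    have : u k < v k := hk
    omega
  · rintro ⟨k, h, hu, hv⟩
    refine ⟨k, h, ?_⟩
    change u k < v k
    rw [hu, hv]; decide

theorem cons_lt_cons {a : Fin 2} {u v : Word} : cons a u ≺ cons a v ↔ u ≺ v := by
  simp only [lexLt_iff]
  constructor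
  · rintro ⟨k, h, hu, hv⟩
    cases k with
    | zero => simp at hu hv; omega
    | succ k => exact ⟨k, agree_cons_iff.1 h, hu, hv⟩
  · rintro ⟨k, h, hu, hv⟩
    exact ⟨k + 1, agree_cons_iff.2 h, hu, hv⟩

theorem cons_le_cons {a : Fin 2} {u v : Word} : cons a u ≼ cons a v ↔ u ≼ v := by
  exact not_lt.symm.trans ((not_congr cons_lt_cons).trans not_lt)

theorem lt_of_head {u v : Word} (hu : u 0 = 0) (hv : v 0 = 1) : u ≺ v :=
  lexLt_iff.2 ⟨0, agree_zero _ _, hu, hv⟩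

theorem const_zero_le (u : Word) : const 0 ≼ u := by
  by_contra h
  obtain ⟨k, -, -, hk⟩ := lexLt_iff.1 (not_le.1 h)
  simp at hk

theorem le_const_one (u : Word) : u ≼ const 1 := by
  by_contra h
  obtain ⟨k, -, hk, -⟩ := lexLt_iff.1 (not_le.1 h)
  simp at hk

theorem le_cons_one (u : Word) : u ≼ cons 1 u := by
  by_contra h
  obtain ⟨k, hk, h0, h1⟩ := lexLt_iff.1 (not_le.1 h)
  have : ∀ i ≤ k, cons 1 u i = 1 := by
    intro i hi
    induction i with
    | zero => rfl
    | succ i ih => rw [cons_succ, ← hk i (by omega)]; exact ih (by omega)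
  rw [this k le_rfl] at h0
  omega

theorem cons_zero_le (u : Word) : cons 0 u ≼ u := by
  by_contra h
  obtain ⟨k, hk, h0, h1⟩ := lexLt_iff.1 (not_le.1 h)
  have : ∀ i ≤ k, cons 0 u i = 0 := by
    intro i hi
    induction i with
    | zero => rfl
    | succ i ih => rw [cons_succ, hk i (by omega)]; exact ih (by omega)
  rw [this k le_rfl] at h1
  omega

/-- The words with a given prefix form a lexicographic interval. -/
theorem Agree.of_between {N : ℕ} {x y z : Word} (h : Agree N x z) (hxy : x ≼ y)
    (hyz : y ≼ z) : Agree N x y := by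
  rcases hxy.eq_or_lt with e | hlt
  · rw [toLex_inj] at e; subst e; exact fun _ _ => rfl
  obtain ⟨k, hk, h0, h1⟩ := lexLt_iff.1 hlt
  by_cases hkN : N ≤ k
  · exact hk.mono hkN
  exfalso
  refine absurd hyz (not_le.2 (lexLt_iff.2 ⟨k, ?_, ?_, h1⟩))
  · exact (h.symm.mono (by omega)).trans hk
  · rw [← h k (by omega)]; exact h0

/-! ### The three substitutions and their action on extremal words -/

theorem onList_append (s : Gen) (l l' : List (Fin 2)) :
    s.onList (l ++ l') = s.onList l ++ s.onList l' := by simp [Gen.onList]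

theorem onList_cons (s : Gen) (a : Fin 2) (l : List (Fin 2)) :
    s.onList (a :: l) = s.letter a ++ s.onList l := by simp [Gen.onList]

theorem length_le_onList (s : Gen) (l : List (Fin 2)) : l.length ≤ (s.onList l).length := by
  induction l with
  | nil => simp
  | cons a l ih =>
    rw [onList_cons, List.length_append, List.length_cons]
    have : 1 ≤ (s.letter a).length := by
      rcases fin2_cases a with rfl | rfl <;> cases s <;> simp [Gen.letter]
    omega

theorem onWord_apply (s : Gen) (u : Word) {k n : ℕ} (h : k < n) :
    s.onWord u k = (s.onList ((List.range n).map u)).getD k 0 := by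
  obtain ⟨d, rfl⟩ := Nat.exists_eq_add_of_le (show k + 1 ≤ n from h)
  rw [List.range_add, List.map_append, onList_append, Gen.onWord, List.getD_append]
  have := length_le_onList s ((List.range (k + 1)).map u)
  simp at this
  omega

/-- The word `w u`, for a finite word `w`. -/
def app (w : List (Fin 2)) (u : Word) : Word := w.foldr cons u

@[simp] theorem app_nil (u : Word) : app [] u = u := rfl

@[simp] theorem app_cons (a : Fin 2) (w : List (Fin 2)) (u : Word) :
    app (a :: w) u = cons a (app w u) := rfl

theorem app_append (w w' : List (Fin 2)) (u : Word) : app (w ++ w') u = app w (app w' u) := by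
  simp [app]

theorem app_apply_lt (w : List (Fin 2)) (u : Word) {k : ℕ} (h : k < w.length) :
    app w u k = w.getD k 0 := by
  induction w generalizing k with
  | nil => simp at h
  | cons a w ih =>
    cases k with
    | zero => rfl
    | succ k => simpa using ih (by simpa using h)

theorem app_apply_add (w : List (Fin 2)) (u : Word) (k : ℕ) : app w u (w.length + k) = u k := by
  induction w with
  | nil => simp
  | cons a w ih => rw [app_cons, List.length_cons, add_right_comm, cons_succ, ih]

theorem drop_app (w : List (Fin 2)) (u : Word) : drop w.length (app w u) = u := by
  funext k; rw [drop_apply, add_comm, app_apply_add]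

theorem onWord_cons (s : Gen) (a : Fin 2) (u : Word) :
    s.onWord (cons a u) = app (s.letter a) (s.onWord u) := by
  funext k
  have hl : 1 ≤ (s.letter a).length := by
    rcases fin2_cases a with rfl | rfl <;> cases s <;> simp [Gen.letter]
  have e : (List.range (k + 1)).map (cons a u) = a :: (List.range k).map u := by
    rw [List.range_succ_eq_map]; simp [Function.comp_def]
  rw [onWord_apply s _ (Nat.lt_succ_self k), e, onList_cons]
  by_cases hk : k < (s.letter a).length
  · rw [List.getD_append _ _ _ _ hk, app_apply_lt _ _ hk]
  · obtain ⟨d, rfl⟩ := Nat.exists_eq_add_of_le (not_lt.1 hk)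
    rw [List.getD_append_right _ _ _ _ (by omega), app_apply_add,
      onWord_apply s _ (show d < (s.letter a).length + d by omega)]
    congr 1; omega

@[simp] theorem onWord_L_zero (u : Word) : Gen.L.onWord (cons 0 u) = cons 0 (Gen.L.onWord u) :=
  onWord_cons _ _ _

@[simp] theorem onWord_L_one (u : Word) :
    Gen.L.onWord (cons 1 u) = cons 0 (cons 1 (Gen.L.onWord u)) := onWord_cons _ _ _

@[simp] theorem onWord_M_zero (u : Word) :
    Gen.M.onWord (cons 0 u) = cons 0 (cons 1 (Gen.M.onWord u)) := onWord_cons _ _ _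

@[simp] theorem onWord_M_one (u : Word) :
    Gen.M.onWord (cons 1 u) = cons 1 (cons 0 (Gen.M.onWord u)) := onWord_cons _ _ _

@[simp] theorem onWord_R_zero (u : Word) :
    Gen.R.onWord (cons 0 u) = cons 0 (cons 1 (Gen.R.onWord u)) := onWord_cons _ _ _

@[simp] theorem onWord_R_one (u : Word) : Gen.R.onWord (cons 1 u) = cons 1 (Gen.R.onWord u) :=
  onWord_cons _ _ _

/-- Case distinction on the first letter. -/
theorem word_cases {p : Word → Prop} (h0 : ∀ w, p (cons 0 w)) (h1 : ∀ w, p (cons 1 w))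
    (u : Word) : p u := by
  rw [← cons_drop_one u]
  rcases fin2_cases (u 0) with h | h <;> rw [h]
  exacts [h0 _, h1 _]

theorem exists_cons_of_head {u : Word} {a : Fin 2} (h : u 0 = a) : ∃ w, u = cons a w :=
  ⟨drop 1 u, by rw [← h, cons_drop_one]⟩

theorem onWord_L_head (u : Word) : Gen.L.onWord u 0 = 0 := by
  induction u using word_cases <;> simp

theorem onWord_head_zero (s : Gen) {u : Word} (h : u 0 = 0) : s.onWord u 0 = 0 := by
  obtain ⟨w, rfl⟩ := exists_cons_of_head h
  cases s <;> simp

theorem onWord_lt (s : Gen) {u v : Word} (h : u ≺ v) : s.onWord u ≺ s.onWord v := by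
  obtain ⟨k, hk, h0, h1⟩ := lexLt_iff.1 h
  clear h
  induction k generalizing u v with
  | zero =>
    obtain ⟨u, rfl⟩ := exists_cons_of_head h0
    obtain ⟨v, rfl⟩ := exists_cons_of_head h1
    cases s
    · rw [onWord_L_zero, onWord_L_one, cons_lt_cons]
      exact lt_of_head (onWord_L_head u) rfl
    · exact lt_of_head (by simp) (by simp)
    · exact lt_of_head (by simp) (by simp)
  | succ k ih =>
    have e : u 0 = v 0 := hk 0 (by omega)
    rw [← cons_drop_one u, ← cons_drop_one v, e] at hk ⊢
    have := ih (agree_cons_iff.1 hk) h0 h1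
    rcases fin2_cases (v 0) with h | h <;> rw [h] <;> cases s <;> simpa [cons_lt_cons] using this

theorem onWord_lt_iff (s : Gen) {u v : Word} : s.onWord u ≺ s.onWord v ↔ u ≺ v := by
  refine ⟨fun h => ?_, onWord_lt s⟩
  rcases lt_trichotomy (toLex u) (toLex v) with h1 | h1 | h1
  · exact h1
  · rw [toLex_inj.1 h1] at h; exact absurd h (lt_irrefl _)
  · exact absurd h (not_lt.2 (onWord_lt s h1).le)

theorem onWord_le (s : Gen) {u v : Word} (h : u ≼ v) : s.onWord u ≼ s.onWord v :=
  not_lt.1 fun h' => absurd h (not_le.2 ((onWord_lt_iff s).1 h'))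

/-- The action of a substitution on the infima of orbits: if `a` is the smallest tail of `v`
and occurs after a letter `1`, then `lo s a` has the same property for `s v`. -/
def lo : Gen → Word → Word
  | .L, u => Gen.L.onWord u
  | .M, u => cons 0 (Gen.M.onWord u)
  | .R, u => Gen.R.onWord u

/-- The action of a substitution on the suprema of orbits: if `b` is the largest tail of `v`
and occurs after a letter `0`, then `hi s b` has the same property for `s v`. -/
def hi : Gen → Word → Word
  | .L, u => drop 1 (Gen.L.onWord u)
  | .M, u => cons 1 (Gen.M.onWord u)
  | .R, u => cons 1 (Gen.R.onWord u)

theorem lo_head (s : Gen) {u : Word} (h : u 0 = 0) : lo s u 0 = 0 := by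
  obtain ⟨w, rfl⟩ := exists_cons_of_head h
  cases s <;> simp [lo]

theorem hi_head (s : Gen) {u : Word} (h : u 0 = 1) : hi s u 0 = 1 := by
  obtain ⟨w, rfl⟩ := exists_cons_of_head h
  cases s <;> simp [hi]

theorem hi_L_cons (w : Word) : hi .L (cons 1 w) = cons 1 (Gen.L.onWord w) := by
  simp [hi]

theorem agree_onWord (s : Gen) {k : ℕ} {u v : Word} (h : Agree k u v) :
    Agree k (s.onWord u) (s.onWord v) := by
  induction k generalizing u v with
  | zero => exact agree_zero _ _
  | succ k ih =>
    have e : u 0 = v 0 := h 0 (by omega)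
    rw [← cons_drop_one u, ← cons_drop_one v, e] at h ⊢
    have := ih (agree_cons_iff.1 h)
    rcases fin2_cases (v 0) with h | h <;> rw [h] <;> cases s <;>
      simp only [onWord_L_zero, onWord_L_one, onWord_M_zero, onWord_M_one, onWord_R_zero,
        onWord_R_one, agree_cons_iff]
    exacts [this, this.cons _, this.cons _, this.cons _, this.cons _, this]

theorem agree_onWord_L {k : ℕ} {u v : Word} (h : Agree k u v) :
    Agree (k + 1) (Gen.L.onWord u) (Gen.L.onWord v) := by
  induction k generalizing u v with
  | zero => exact agree_one (by rw [onWord_L_head, onWord_L_head])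
  | succ k ih =>
    have e : u 0 = v 0 := h 0 (by omega)
    rw [← cons_drop_one u, ← cons_drop_one v, e] at h ⊢
    have := ih (agree_cons_iff.1 h)
    rcases fin2_cases (v 0) with h | h <;> rw [h] <;>
      simp only [onWord_L_zero, onWord_L_one, agree_cons_iff]
    exacts [this, this.mono (Nat.le_succ k)]

/-- Common prefixes of words that begin with `0` grow under `lo s`. -/
theorem agree_lo (s : Gen) {k : ℕ} {u v : Word} (hu : u 0 = 0) (h : Agree (k + 1) u v) :
    Agree (k + 2) (lo s u) (lo s v) := by
  cases s
  · exact agree_onWord_L h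
  · exact agree_cons_iff.2 (agree_onWord .M h)
  · have hv : v 0 = 0 := by rw [← h 0 (by omega), hu]
    obtain ⟨u, rfl⟩ := exists_cons_of_head hu
    obtain ⟨v, rfl⟩ := exists_cons_of_head hv
    simp only [lo, onWord_R_zero, agree_cons_iff]
    exact agree_onWord .R (agree_cons_iff.1 h)

/-- Common prefixes of words that begin with `1` grow under `hi s`. -/
theorem agree_hi (s : Gen) {k : ℕ} {u v : Word} (hu : u 0 = 1) (h : Agree (k + 1) u v) :
    Agree (k + 2) (hi s u) (hi s v) := by
  cases s
  · have hv : v 0 = 1 := by rw [← h 0 (by omega), hu]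
    obtain ⟨u, rfl⟩ := exists_cons_of_head hu
    obtain ⟨v, rfl⟩ := exists_cons_of_head hv
    rw [hi_L_cons, hi_L_cons]
    exact agree_cons_iff.2 (agree_onWord_L (agree_cons_iff.1 h))
  · exact agree_cons_iff.2 (agree_onWord .M h)
  · exact agree_cons_iff.2 (agree_onWord .R h)

/-- The image of a substitution on the infima of orbits, for products. -/
def loList (σ : List Gen) (u : Word) : Word := σ.foldr lo u

/-- The image of a substitution on the suprema of orbits, for products. -/
def hiList (σ : List Gen) (u : Word) : Word := σ.foldr hi u

@[simp] theorem loList_nil (u : Word) : loList [] u = u := rfl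

@[simp] theorem loList_cons (s : Gen) (σ : List Gen) (u : Word) :
    loList (s :: σ) u = lo s (loList σ u) := rfl

@[simp] theorem hiList_nil (u : Word) : hiList [] u = u := rfl

@[simp] theorem hiList_cons (s : Gen) (σ : List Gen) (u : Word) :
    hiList (s :: σ) u = hi s (hiList σ u) := rfl

theorem loList_append (σ τ : List Gen) (u : Word) :
    loList (σ ++ τ) u = loList σ (loList τ u) := by simp [loList]

theorem hiList_append (σ τ : List Gen) (u : Word) :
    hiList (σ ++ τ) u = hiList σ (hiList τ u) := by simp [hiList]

theorem loList_head (σ : List Gen) {u : Word} (h : u 0 = 0) : loList σ u 0 = 0 := by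
  induction σ with
  | nil => exact h
  | cons s σ ih => exact lo_head s ih

theorem hiList_head (σ : List Gen) {u : Word} (h : u 0 = 1) : hiList σ u 0 = 1 := by
  induction σ with
  | nil => exact h
  | cons s σ ih => exact hi_head s ih

theorem agree_loList (σ : List Gen) {k : ℕ} {u v : Word} (hu : u 0 = 0)
    (h : Agree (k + 1) u v) : Agree (k + σ.length + 1) (loList σ u) (loList σ v) := by
  induction σ with
  | nil => exact h
  | cons s σ ih => exact agree_lo s (loList_head σ hu) ih

theorem agree_hiList (σ : List Gen) {k : ℕ} {u v : Word} (hu : u 0 = 1)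
    (h : Agree (k + 1) u v) : Agree (k + σ.length + 1) (hiList σ u) (hiList σ v) := by
  induction σ with
  | nil => exact h
  | cons s σ ih => exact agree_hi s (hiList_head σ hu) ih

theorem agree_loList_of_head (σ : List Gen) {u v : Word} (hu : u 0 = 0) (hv : v 0 = 0) :
    Agree (σ.length + 1) (loList σ u) (loList σ v) :=
  (agree_loList σ (k := 0) hu (agree_one (hu.trans hv.symm))).mono (by omega)

theorem agree_hiList_of_head (σ : List Gen) {u v : Word} (hu : u 0 = 1) (hv : v 0 = 1) :
    Agree (σ.length + 1) (hiList σ u) (hiList σ v) :=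
  (agree_hiList σ (k := 0) hu (agree_one (hu.trans hv.symm))).mono (by omega)

@[simp] theorem listOnWord_nil (u : Word) : listOnWord [] u = u := rfl

@[simp] theorem listOnWord_cons (s : Gen) (σ : List Gen) (u : Word) :
    listOnWord (s :: σ) u = s.onWord (listOnWord σ u) := rfl

theorem listOnWord_append (σ τ : List Gen) (u : Word) :
    listOnWord (σ ++ τ) u = listOnWord σ (listOnWord τ u) := by simp [listOnWord]

/-! ### Tails of images under substitutions -/

/-- Every tail of `u` lies in the lexicographic interval `[a, b]`. -/
def Within (a b u : Word) : Prop := ∀ n, a ≼ drop n u ∧ drop n u ≼ b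

/-- A tail of `s u` begins at the image of a letter, or at the second letter of such an image. -/
theorem drop_onWord_cases (s : Gen) (u : Word) (n : ℕ) :
    (∃ k, drop n (s.onWord u) = s.onWord (drop k u)) ∨
      ∃ k c, (∃ d, s.letter (u k) = [d, c]) ∧
        drop n (s.onWord u) = cons c (s.onWord (drop (k + 1) u)) := by
  induction n with
  | zero => exact Or.inl ⟨0, rfl⟩
  | succ n ih =>
    have e : drop (n + 1) (s.onWord u) = drop 1 (drop n (s.onWord u)) := by
      rw [drop_drop, add_comm]
    rw [e]
    rcases ih with ⟨k, hk⟩ | ⟨k, c, -, hk⟩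
    · rw [hk, ← cons_drop u k, onWord_cons]
      have : (∃ d, s.letter (u k) = [d]) ∨ ∃ d c, s.letter (u k) = [d, c] := by
        rcases fin2_cases (u k) with h | h <;> rw [h] <;> cases s <;> simp [Gen.letter]
      rcases this with ⟨d, hd⟩ | ⟨d, c, hd⟩
      · exact Or.inl ⟨k + 1, by rw [hd]; rfl⟩
      · exact Or.inr ⟨k, c, ⟨d, hd⟩, by rw [hd]; rfl⟩
    · exact Or.inl ⟨k + 1, by rw [hk, drop_one_cons]⟩

/-- Each tail of `u` gives a tail of `s u`, at a position that is at least as large. -/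
theorem exists_drop_onWord (s : Gen) (u : Word) (k : ℕ) :
    ∃ n, k ≤ n ∧ drop n (s.onWord u) = s.onWord (drop k u) := by
  induction k with
  | zero => exact ⟨0, le_rfl, rfl⟩
  | succ k ih =>
    obtain ⟨n, hkn, hn⟩ := ih
    have hl : 1 ≤ (s.letter (u k)).length := by
      rcases fin2_cases (u k) with h | h <;> rw [h] <;> cases s <;> simp [Gen.letter]
    refine ⟨(s.letter (u k)).length + n, by omega, ?_⟩
    rw [← drop_drop, hn, ← cons_drop u k, onWord_cons, drop_app]

theorem Within.onWord {s : Gen} {a b u : Word} (ha : a 0 = 0) (hb : b 0 = 1)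
    (h : Within a b u) : Within (lo s a) (hi s b) (s.onWord u) := by
  intro n
  obtain ⟨a', rfl⟩ := exists_cons_of_head ha
  obtain ⟨b', rfl⟩ := exists_cons_of_head hb
  have hs : ∀ k, s.onWord (cons 0 a') ≼ s.onWord (drop k u) ∧
      s.onWord (drop k u) ≼ s.onWord (cons 1 b') :=
    fun k => ⟨onWord_le s (h k).1, onWord_le s (h k).2⟩
  rcases drop_onWord_cases s u n with ⟨k, hk⟩ | ⟨k, c, ⟨d, hd⟩, hk⟩
  · rw [hk]
    obtain ⟨h1, h2⟩ := hs k
    cases s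
    · exact ⟨h1, (lt_of_head (onWord_L_head _) (hi_head .L rfl)).le⟩
    · exact ⟨(cons_zero_le _).trans h1, h2.trans (le_cons_one _)⟩
    · exact ⟨h1, h2.trans (le_cons_one _)⟩
  · rw [hk]
    obtain ⟨h1, h2⟩ := hs (k + 1)
    cases s
    · have hu : u k = 1 ∧ c = 1 := by
        rcases fin2_cases (u k) with e | e <;> rw [e] at hd <;> simp [Gen.letter] at hd
        exact ⟨e, hd.2.symm⟩
      obtain ⟨hu, rfl⟩ := hu
      refine ⟨(lt_of_head (onWord_L_head _) rfl).le, ?_⟩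
      have := (hs k).2
      rw [← cons_drop u k, hu, onWord_L_one, onWord_L_one, cons_le_cons] at this
      rwa [hi_L_cons]
    · rcases fin2_cases c with rfl | rfl
      · exact ⟨cons_le_cons.2 h1, (lt_of_head rfl rfl).le⟩
      · exact ⟨(lt_of_head rfl rfl).le, cons_le_cons.2 h2⟩
    · have hc : c = 1 := by
        rcases fin2_cases (u k) with e | e <;> rw [e] at hd <;> simp [Gen.letter] at hd
        exact hd.2.symm
      subst hc
      exact ⟨(lt_of_head (by simp [lo]) rfl).le, cons_le_cons.2 h2⟩

theorem Within.listOnWord {a b u : Word} (ha : a 0 = 0) (hb : b 0 = 1)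
    (h : Within a b u) (σ : List Gen) :
    Within (loList σ a) (hiList σ b) (listOnWord σ u) := by
  induction σ with
  | nil => exact h
  | cons s σ ih => exact ih.onWord (loList_head σ ha) (hiList_head σ hb)

theorem within_const (u : Word) : Within (const 0) (const 1) u :=
  fun _ => ⟨const_zero_le _, le_const_one _⟩

theorem exists_lo_tail (s : Gen) {u : Word} {k : ℕ} (h : u k = 1) :
    ∃ n, s.onWord u n = 1 ∧ drop (n + 1) (s.onWord u) = lo s (drop (k + 1) u) := by
  obtain ⟨n, -, hn⟩ := exists_drop_onWord s u k
  rw [← cons_drop u k, h] at hn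
  have key : ∀ j, s.onWord u (j + n) = drop n (s.onWord u) j ∧
      drop (j + n + 1) (s.onWord u) = drop (j + 1) (drop n (s.onWord u)) :=
    fun j => ⟨rfl, by rw [drop_drop]; congr 1; omega⟩
  rw [hn] at key
  cases s
  · exact ⟨1 + n, (key 1).1.trans (by simp), (key 1).2.trans (by simp [lo])⟩
  · exact ⟨0 + n, (key 0).1.trans (by simp), (key 0).2.trans (by simp [lo])⟩
  · exact ⟨0 + n, (key 0).1.trans (by simp), (key 0).2.trans (by simp [lo])⟩

theorem exists_hi_tail (s : Gen) {u : Word} {k : ℕ} (h : u k = 0) :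
    ∃ n, s.onWord u n = 0 ∧ drop (n + 1) (s.onWord u) = hi s (drop (k + 1) u) := by
  obtain ⟨n, -, hn⟩ := exists_drop_onWord s u k
  rw [← cons_drop u k, h] at hn
  have key : ∀ j, s.onWord u (j + n) = drop n (s.onWord u) j ∧
      drop (j + n + 1) (s.onWord u) = drop (j + 1) (drop n (s.onWord u)) :=
    fun j => ⟨rfl, by rw [drop_drop]; congr 1; omega⟩
  rw [hn] at key
  cases s
  · exact ⟨1 + n, (key 1).1.trans (by simp [onWord_L_head]), (key 1).2.trans (by simp [hi])⟩
  · exact ⟨0 + n, (key 0).1.trans (by simp), (key 0).2.trans (by simp [hi])⟩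
  · exact ⟨0 + n, (key 0).1.trans (by simp), (key 0).2.trans (by simp [hi])⟩

/-- `a` and `b` are the smallest and the largest tail of `u`, `a` occurs after a letter `1`
and `b` after a letter `0`. In contrast to being just extremal tails, this property is
transported by substitutions. -/
structure Extremal (a b u : Word) : Prop where
  within : Within a b u
  lo_head : a 0 = 0
  hi_head : b 0 = 1
  lo_tail : ∃ k, u k = 1 ∧ drop (k + 1) u = a
  hi_tail : ∃ k, u k = 0 ∧ drop (k + 1) u = b

theorem Extremal.onWord {a b u : Word} (h : Extremal a b u) (s : Gen) :
    Extremal (lo s a) (hi s b) (s.onWord u) where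
  within := h.within.onWord h.lo_head h.hi_head
  lo_head := TMS.lo_head s h.lo_head
  hi_head := TMS.hi_head s h.hi_head
  lo_tail := by
    obtain ⟨k, hk, e⟩ := h.lo_tail
    rw [← e]; exact exists_lo_tail s hk
  hi_tail := by
    obtain ⟨k, hk, e⟩ := h.hi_tail
    rw [← e]; exact exists_hi_tail s hk

theorem Extremal.listOnWord {a b u : Word} (h : Extremal a b u) (σ : List Gen) :
    Extremal (loList σ a) (hiList σ b) (listOnWord σ u) := by
  induction σ with
  | nil => exact h
  | cons s σ ih => exact ih.onWord s

theorem drop_mem_orbit (u : Word) (n : ℕ) : toLex (drop n u) ∈ orbit u := ⟨n, rfl⟩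

theorem infO_le (u : Word) (n : ℕ) : infO u ≼ drop n u := sInf_le (drop_mem_orbit u n)

theorem le_supO (u : Word) (n : ℕ) : drop n u ≼ supO u := le_sSup (drop_mem_orbit u n)

theorem le_infO {u a : Word} (h : ∀ n, a ≼ drop n u) : a ≼ infO u :=
  le_sInf (by rintro _ ⟨n, rfl⟩; exact h n)

theorem supO_le {u b : Word} (h : ∀ n, drop n u ≼ b) : supO u ≼ b :=
  sSup_le (by rintro _ ⟨n, rfl⟩; exact h n)

theorem Extremal.infO_eq {a b u : Word} (h : Extremal a b u) : infO u = a := by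
  obtain ⟨k, -, e⟩ := h.lo_tail
  have h1 := infO_le u (k + 1)
  rw [e] at h1
  exact toLex_inj.1 (le_antisymm h1 (le_infO fun n => (h.within n).1))

theorem Extremal.supO_eq {a b u : Word} (h : Extremal a b u) : supO u = b := by
  obtain ⟨k, -, e⟩ := h.hi_tail
  have h1 := le_supO u (k + 1)
  rw [e] at h1
  exact toLex_inj.1 (le_antisymm (supO_le fun n => (h.within n).2) h1)

theorem Extremal.lo_le_tail {a b u : Word} (h : Extremal a b u) : a ≼ drop 1 b := by
  obtain ⟨k, -, e⟩ := h.hi_tail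
  rw [← e, drop_drop]
  exact (h.within _).1

/-! ### Words whose tails lie in an open lexicographic interval -/

/-- Every tail of `u` lies in the open lexicographic interval `(a, b)`. -/
def Inside (a b u : Word) : Prop := ∀ n, a ≺ drop n u ∧ drop n u ≺ b

theorem Inside.tail {a b u : Word} (h : Inside a b u) (n : ℕ) : Inside a b (drop n u) :=
  fun k => by rw [drop_drop]; exact h _

theorem lo_lt_iff (s : Gen) {u v : Word} : lo s u ≺ lo s v ↔ u ≺ v := by
  cases s
  · exact onWord_lt_iff .L
  · exact cons_lt_cons.trans (onWord_lt_iff .M)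
  · exact onWord_lt_iff .R

theorem hi_lt_iff (s : Gen) {u v : Word} : hi s u ≺ hi s v ↔ u ≺ v := by
  cases s
  · have h : ∀ w, Gen.L.onWord w = cons 0 (hi .L w) := fun w => by
      rw [hi, ← onWord_L_head w, cons_drop_one]
    rw [← onWord_lt_iff .L (u := u), h, h, cons_lt_cons]
  · exact cons_lt_cons.trans (onWord_lt_iff .M)
  · exact cons_lt_cons.trans (onWord_lt_iff .R)

theorem exists_eq_app_drop (u : Word) (n : ℕ) : ∃ l, u = app l (drop n u) := by
  induction n with
  | zero => exact ⟨[], rfl⟩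
  | succ n ih =>
    obtain ⟨l, hl⟩ := ih
    refine ⟨l ++ [u n], ?_⟩
    rw [app_append, app_cons, app_nil, cons_drop]
    exact hl

theorem countable_eventually_mem {C : Set Word} (hC : C.Countable) :
    {u : Word | ∃ n, drop n u ∈ C}.Countable := by
  refine ((Set.countable_univ (α := List (Fin 2))).image2 hC app).mono ?_
  rintro u ⟨n, hn⟩
  obtain ⟨l, hl⟩ := exists_eq_app_drop u n
  exact ⟨l, trivial, _, hn, hl.symm⟩

theorem eq_of_forall_agree {u v : Word} (h : ∀ N, Agree N u v) : u = v :=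
  funext fun i => h (i + 1) i (Nat.lt_succ_self i)

theorem agree_app {l : List (Fin 2)} (hl : l ≠ []) {N : ℕ} {u v : Word} (h : Agree N u v) :
    Agree (N + 1) (app l u) (app l v) := by
  induction l with
  | nil => exact absurd rfl hl
  | cons a l ih =>
    refine agree_cons_iff.2 ?_
    by_cases hl' : l = []
    · subst hl'; exact h
    · exact (ih hl').mono (Nat.le_succ N)

/-- A word is an image under `s` if blocks `s(0)` or `s(1)` can be removed forever, where `I` is
an invariant of this process. -/
theorem exists_eq_onWord (s : Gen) (I : Word → Prop)
    (hI : ∀ t, I t → ∃ a t', t = app (s.letter a) t' ∧ I t') {t : Word} (ht : I t) :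
    ∃ v, t = s.onWord v := by
  choose! a f hf using hI
  have hfI : ∀ n, I (f^[n] t) := by
    intro n
    induction n with
    | zero => exact ht
    | succ n ih => rw [Function.iterate_succ_apply']; exact (hf _ ih).2
  refine ⟨fun n => a (f^[n] t), eq_of_forall_agree fun N => ?_⟩
  have key : ∀ N n, Agree N (f^[n] t) (s.onWord (drop n fun n => a (f^[n] t))) := by
    intro N
    induction N with
    | zero => exact fun _ => agree_zero _ _
    | succ N ih =>
      intro n
      have e := (hf _ (hfI n)).1
      rw [← Function.iterate_succ_apply' f] at e
      rw [← cons_drop, onWord_cons]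
      refine Agree.trans (fun i _ => congrFun e i) (agree_app ?_ (ih (n + 1)))
      rcases fin2_cases (a (f^[n] t)) with h | h <;> rw [h] <;> cases s <;> simp [Gen.letter]
  exact key N 0

theorem exists_eq_onWord_L {t : Word} (h0 : t 0 = 0) (h : ∀ k, t k = 1 → t (k + 1) = 0) :
    ∃ v, t = Gen.L.onWord v := by
  refine exists_eq_onWord .L (fun t => t 0 = 0 ∧ ∀ k, t k = 1 → t (k + 1) = 0) ?_ ⟨h0, h⟩
  rintro t ⟨h0, h⟩
  obtain ⟨t, rfl⟩ := exists_cons_of_head h0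
  rcases fin2_cases (t 0) with h1 | h1
  · exact ⟨0, t, rfl, h1, fun k => h (k + 1)⟩
  · obtain ⟨t, rfl⟩ := exists_cons_of_head h1
    exact ⟨1, t, rfl, h 1 h1, fun k => h (k + 2)⟩

theorem exists_eq_onWord_R {t : Word} (h : ∀ k, t k = 0 → t (k + 1) = 1) :
    ∃ v, t = Gen.R.onWord v := by
  refine exists_eq_onWord .R (fun t => ∀ k, t k = 0 → t (k + 1) = 1) ?_ h
  intro t h
  rcases fin2_cases (t 0) with h0 | h0
  · obtain ⟨t, rfl⟩ := exists_cons_of_head h0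
    obtain ⟨t, rfl⟩ := exists_cons_of_head (show t 0 = 1 from h 0 h0)
    exact ⟨0, t, rfl, fun k => h (k + 2)⟩
  · obtain ⟨t, rfl⟩ := exists_cons_of_head h0
    exact ⟨1, t, rfl, fun k => h (k + 1)⟩

theorem M_const_zero : Gen.M.onWord (const 0) = cons 0 (cons 1 (Gen.M.onWord (const 0))) := by
  conv_lhs => rw [← cons_const, onWord_M_zero]

theorem M_const_one : Gen.M.onWord (const 1) = cons 1 (cons 0 (Gen.M.onWord (const 1))) := by
  conv_lhs => rw [← cons_const, onWord_M_one]

theorem exists_eq_onWord_M_of_alternating {t : Word} (h : ∀ k, t k ≠ t (k + 1)) :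
    ∃ v, t = Gen.M.onWord v := by
  refine exists_eq_onWord .M (fun t => ∀ k, t k ≠ t (k + 1)) ?_ h
  intro t h
  rcases fin2_cases (t 0) with h0 | h0
  · have h1 : t 1 = 1 := by have := h 0; simp only [zero_add] at this; omega
    obtain ⟨t, rfl⟩ := exists_cons_of_head h0
    obtain ⟨t, rfl⟩ := exists_cons_of_head (show t 0 = 1 from h1)
    exact ⟨0, t, rfl, fun k => h (k + 2)⟩
  · have h1 : t 1 = 0 := by have := h 0; simp only [zero_add] at this; omega
    obtain ⟨t, rfl⟩ := exists_cons_of_head h0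
    obtain ⟨t, rfl⟩ := exists_cons_of_head (show t 0 = 0 from h1)
    exact ⟨1, t, rfl, fun k => h (k + 2)⟩

/-- The extremal interval for `M` is `(00101⋯, 11010⋯)`. A tail that lies between
`0101⋯` and `1010⋯` begins with `01` or `10`, and what follows lies again between these words. -/
theorem exists_eq_onWord_M {t : Word}
    (h : Inside (cons 0 (Gen.M.onWord (const 0))) (cons 1 (Gen.M.onWord (const 1))) t)
    (h0 : Gen.M.onWord (const 0) ≺ t) (h1 : t ≺ Gen.M.onWord (const 1)) :
    ∃ v, t = Gen.M.onWord v := by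
  refine exists_eq_onWord .M (fun t =>
    Inside (cons 0 (Gen.M.onWord (const 0))) (cons 1 (Gen.M.onWord (const 1))) t ∧
      Gen.M.onWord (const 0) ≺ t ∧ t ≺ Gen.M.onWord (const 1)) ?_ ⟨h, h0, h1⟩
  clear h h0 h1
  rintro t ⟨h, h0, h1⟩
  induction t using word_cases with
  | h0 t =>
    rw [M_const_zero, cons_lt_cons] at h0
    induction t using word_cases with
    | h0 t => exact absurd h0 (lt_of_head rfl rfl).not_gt
    | h1 t =>
      refine ⟨0, t, rfl, h.tail 2, cons_lt_cons.1 h0, ?_⟩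
      exact cons_lt_cons.1 (h 1).2
  | h1 t =>
    rw [M_const_one, cons_lt_cons] at h1
    induction t using word_cases with
    | h0 t =>
      refine ⟨1, t, rfl, h.tail 2, ?_, cons_lt_cons.1 h1⟩
      exact cons_lt_cons.1 (h 1).1
    | h1 t => exact absurd h1 (lt_of_head rfl rfl).not_gt

theorem Inside.exists_drop_eq_onWord {a b u : Word} (ha : a 0 = 0) (hb : b 0 = 1) (s : Gen)
    (h : Inside (lo s a) (hi s b) u) : ∃ n v, drop n u = s.onWord v := by
  obtain ⟨a', rfl⟩ := exists_cons_of_head ha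
  obtain ⟨b', rfl⟩ := exists_cons_of_head hb
  cases s
  · have h11 : ∀ k, u k = 1 → u (k + 1) = 0 := by
      intro k hk
      by_contra h1
      have := (h k).2
      rw [← cons_drop u k, hk, hi_L_cons, cons_lt_cons] at this
      refine this.not_gt (lt_of_head (onWord_L_head _) ?_)
      simp only [drop_apply, zero_add]; omega
    rcases fin2_cases (u 0) with h0 | h0
    · exact ⟨0, exists_eq_onWord_L h0 h11⟩
    · exact ⟨1, exists_eq_onWord_L (h11 0 h0) fun k => h11 (k + 1)⟩
  · have h' : Inside (cons 0 (Gen.M.onWord (const 0))) (cons 1 (Gen.M.onWord (const 1))) u :=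
      fun n => ⟨(cons_le_cons.2 (onWord_le .M (const_zero_le _))).trans_lt (h n).1,
        (h n).2.trans_le (cons_le_cons.2 (onWord_le .M (le_const_one _)))⟩
    by_cases halt : ∀ k, u k ≠ u (k + 1)
    · exact ⟨0, exists_eq_onWord_M_of_alternating halt⟩
    push Not at halt
    obtain ⟨k, hk⟩ := halt
    obtain ⟨h0, h1⟩ := h' k
    rw [← cons_drop u k] at h0 h1
    refine ⟨k + 1, exists_eq_onWord_M (h'.tail (k + 1)) ?_ ?_⟩
    · rcases fin2_cases (u k) with e | e
      · rw [e] at h0; exact cons_lt_cons.1 h0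
      · refine lt_of_head (by rw [M_const_zero]; rfl) ?_
        simpa [← hk] using e
    · rcases fin2_cases (u k) with e | e
      · refine lt_of_head ?_ (by rw [M_const_one]; rfl)
        simpa [← hk] using e
      · rw [e] at h1; exact cons_lt_cons.1 h1
  · refine ⟨0, exists_eq_onWord_R (t := u) fun k hk => ?_⟩
    by_contra h1
    have := (h k).1
    have e : u (k + 1) = 0 := by omega
    rw [← cons_drop u k, hk, lo, onWord_R_zero, cons_lt_cons] at this
    exact this.not_gt (lt_of_head (by simpa using e) rfl)

theorem exists_lo_tail_list (σ : List Gen) {u : Word} {k : ℕ} (h : u k = 1) :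
    ∃ n, listOnWord σ u n = 1 ∧
      drop (n + 1) (listOnWord σ u) = loList σ (drop (k + 1) u) := by
  induction σ with
  | nil => exact ⟨k, h, rfl⟩
  | cons s σ ih =>
    obtain ⟨n, hn, e⟩ := ih
    obtain ⟨p, hp, e'⟩ := exists_lo_tail s hn
    exact ⟨p, hp, by rw [listOnWord_cons, e', e, loList_cons]⟩

theorem exists_hi_tail_list (σ : List Gen) {u : Word} {k : ℕ} (h : u k = 0) :
    ∃ n, listOnWord σ u n = 0 ∧
      drop (n + 1) (listOnWord σ u) = hiList σ (drop (k + 1) u) := by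
  induction σ with
  | nil => exact ⟨k, h, rfl⟩
  | cons s σ ih =>
    obtain ⟨n, hn, e⟩ := ih
    obtain ⟨p, hp, e'⟩ := exists_hi_tail s hn
    exact ⟨p, hp, by rw [listOnWord_cons, e', e, hiList_cons]⟩

/-- Up to finite prefixes and up to the images of constant words, the words inside
`(lo s a, hi s b)` are the images of the words inside `(a, b)`. -/
theorem countable_inside_step {a b : Word} (ha : a 0 = 0) (hb : b 0 = 1) (s : Gen)
    (hK : {u | Inside a b u}.Countable) : {u | Inside (lo s a) (hi s b) u}.Countable := by
  have hC : (s.onWord '' ({u | Inside a b u} ∪ {const 0, const 1})).Countable :=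
    (hK.union (Set.toFinite _).countable).image _
  refine (countable_eventually_mem hC).mono fun u hu => ?_
  obtain ⟨n, v, hv⟩ := Inside.exists_drop_eq_onWord ha hb s hu
  have hsv : Inside (lo s a) (hi s b) (s.onWord v) := hv ▸ hu.tail n
  have h1 : ∀ k, v k = 1 → a ≺ drop (k + 1) v := by
    intro k hk
    obtain ⟨p, -, e⟩ := exists_lo_tail s hk
    exact (lo_lt_iff s).1 (e ▸ (hsv (p + 1)).1)
  have h0 : ∀ k, v k = 0 → drop (k + 1) v ≺ b := by
    intro k hk
    obtain ⟨p, -, e⟩ := exists_hi_tail s hk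
    exact (hi_lt_iff s).1 (e ▸ (hsv (p + 1)).2)
  by_cases hv0 : ∃ i, v i = 0
  swap
  · refine ⟨n, v, Or.inr (Or.inr (funext fun i => ?_)), hv.symm⟩
    by_contra hi'
    exact hv0 ⟨i, by simp only [const_apply] at hi'; omega⟩
  by_cases hv1 : ∃ i, v i = 1
  swap
  · refine ⟨n, v, Or.inr (Or.inl (funext fun i => ?_)), hv.symm⟩
    by_contra hi'
    exact hv1 ⟨i, by simp only [const_apply] at hi'; omega⟩
  obtain ⟨i, hi'⟩ := hv0
  obtain ⟨j, hj⟩ := hv1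
  have hlow : ∀ d, a ≺ drop (d + (j + 1)) v := by
    intro d
    induction d with
    | zero => rw [zero_add]; exact h1 j hj
    | succ d ih =>
      rw [← cons_drop v (d + (j + 1))] at ih
      rw [add_right_comm]
      rcases fin2_cases (v (d + (j + 1))) with e | e
      · rw [e] at ih; exact ih.trans_le (cons_zero_le _)
      · exact h1 _ e
  have hup : ∀ d, drop (d + (i + 1)) v ≺ b := by
    intro d
    induction d with
    | zero => rw [zero_add]; exact h0 i hi'
    | succ d ih =>
      rw [← cons_drop v (d + (i + 1))] at ih
      rw [add_right_comm]
      rcases fin2_cases (v (d + (i + 1))) with e | e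
      · exact h0 _ e
      · rw [e] at ih; exact (le_cons_one _).trans_lt ih
  obtain ⟨p, -, hp⟩ := exists_drop_onWord s v (i + j + 1)
  refine ⟨p + n, drop (i + j + 1) v, Or.inl fun k => ?_, ?_⟩
  · rw [drop_drop]
    constructor
    · rw [show k + (i + j + 1) = k + i + (j + 1) by omega]; exact hlow _
    · rw [show k + (i + j + 1) = k + j + (i + 1) by omega]; exact hup _
  · rw [← hp, ← hv, drop_drop]

theorem countable_inside (σ : List Gen) :
    {u | Inside (loList σ (const 0)) (hiList σ (cons 1 (const 0))) u}.Countable := by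
  induction σ with
  | nil =>
    refine Set.countable_empty.mono fun u hu => ?_
    have h0 : ∀ k, u k = 0 := by
      intro k
      by_contra hk
      have h1 : u k = 1 := by omega
      have := (hu k).2
      rw [← cons_drop u k, h1] at this
      exact absurd (const_zero_le _) (not_le.2 (cons_lt_cons.1 this))
    have := (hu 0).1
    rw [drop_zero, show u = const 0 from funext h0] at this
    exact lt_irrefl _ this
  | cons s σ ih => exact countable_inside_step (loList_head σ rfl) (hiList_head σ rfl) s ih

/-! ### Pairs of words that are approximated by substitutions -/

/-- The pair `(a, b)` is a limit of the pairs `(loList σ x, hiList σ y)`, uniformly in the words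
`x` and `y` that begin with `0` and `1`. -/
def Approx (a b : Word) : Prop :=
  ∀ N, ∃ σ : List Gen, ∀ x y : Word, x 0 = 0 → y 0 = 1 →
    Agree N a (loList σ x) ∧ Agree N b (hiList σ y)

theorem eq_const_of_eq_cons {a : Fin 2} {u : Word} (h : u = cons a u) : u = const a := by
  funext k
  induction k with
  | zero => rw [h]; rfl
  | succ k ih => rw [h]; exact ih

theorem L_const_zero : Gen.L.onWord (const 0) = const 0 :=
  eq_const_of_eq_cons (by rw [← onWord_L_zero, cons_const])

theorem R_const_one : Gen.R.onWord (const 1) = const 1 :=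
  eq_const_of_eq_cons (by rw [← onWord_R_one, cons_const])

theorem lo_L_const_zero : lo .L (const 0) = const 0 := L_const_zero

theorem hi_L_one_zero : hi .L (cons 1 (const 0)) = cons 1 (const 0) := by
  rw [hi_L_cons, L_const_zero]

theorem lo_R_zero_one : lo .R (cons 0 (const 1)) = cons 0 (const 1) := by
  rw [lo, onWord_R_zero, R_const_one, cons_const]

theorem hi_R_const_one : hi .R (const 1) = const 1 := by
  rw [hi, R_const_one, cons_const]

theorem foldr_replicate_fixed {α β : Type*} (F : α → β → β) (s : α) {x : β} (h : F s x = x)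
    (n : ℕ) : (List.replicate n s).foldr F x = x := by
  induction n with
  | zero => rfl
  | succ n ih => rw [List.replicate_succ, List.foldr_cons, ih, h]

/-- Fixed pairs of a substitution, and their images, are approximated by the powers of this
substitution. -/
theorem agree_replicate (s : Gen) {a b : Word} (ha0 : a 0 = 0) (hb0 : b 0 = 1)
    (ha : lo s a = a) (hb : hi s b = b) (σ : List Gen) (n : ℕ) {x y : Word} (hx : x 0 = 0)
    (hy : y 0 = 1) :
    Agree (n + 1) (loList σ a) (loList (σ ++ List.replicate n s) x) ∧
      Agree (n + 1) (hiList σ b) (hiList (σ ++ List.replicate n s) y) := by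
  have h1 := agree_loList_of_head (σ ++ List.replicate n s) ha0 hx
  have h2 := agree_hiList_of_head (σ ++ List.replicate n s) hb0 hy
  rw [loList_append _ _ a, loList, loList, foldr_replicate_fixed lo s ha n] at h1
  rw [hiList_append _ _ b, hiList, hiList, foldr_replicate_fixed hi s hb n] at h2
  exact ⟨h1.mono (by simp), h2.mono (by simp)⟩

theorem approx_replicate (s : Gen) {a b : Word} (ha0 : a 0 = 0) (hb0 : b 0 = 1)
    (ha : lo s a = a) (hb : hi s b = b) (σ : List Gen) : Approx (loList σ a) (hiList σ b) := by
  intro N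
  refine ⟨σ ++ List.replicate N s, fun x y hx hy => ?_⟩
  have := agree_replicate s ha0 hb0 ha hb σ N hx hy
  exact ⟨this.1.mono (by omega), this.2.mono (by omega)⟩

theorem approx_lower (σ : List Gen) :
    Approx (loList σ (const 0)) (hiList σ (cons 1 (const 0))) :=
  approx_replicate .L rfl rfl lo_L_const_zero hi_L_one_zero σ

theorem approx_upper (σ : List Gen) :
    Approx (loList σ (cons 0 (const 1))) (hiList σ (const 1)) :=
  approx_replicate .R rfl rfl lo_R_zero_one hi_R_const_one σ

/-! ### The words at the ends of the plateaus -/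

theorem evConst_eq_app (w : List (Fin 2)) (a : Fin 2) : evConst w a = app w (const a) := by
  funext k
  by_cases hk : k < w.length
  · rw [app_apply_lt _ _ hk, evConst, List.getD_eq_getElem _ _ hk, List.getD_eq_getElem _ _ hk]
  · obtain ⟨d, rfl⟩ := Nat.exists_eq_add_of_le (not_lt.1 hk)
    rw [app_apply_add, evConst, List.getD_eq_default _ _ (by omega), const_apply]

theorem extremal_zero_one : Extremal (const 0) (cons 1 (const 0)) (evConst [0, 1] 0) := by
  rw [evConst_eq_app]
  refine ⟨?_, rfl, rfl, ⟨1, rfl, rfl⟩, ⟨0, rfl, rfl⟩⟩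
  intro n
  refine ⟨const_zero_le _, ?_⟩
  rcases n with _ | _ | n
  · exact (lt_of_head rfl rfl).le
  · exact le_rfl
  · exact (const_zero_le _)

theorem extremal_one_zero : Extremal (cons 0 (const 1)) (const 1) (evConst [1, 0] 1) := by
  rw [evConst_eq_app]
  refine ⟨?_, rfl, rfl, ⟨0, rfl, rfl⟩, ⟨1, rfl, rfl⟩⟩
  intro n
  refine ⟨?_, le_const_one _⟩
  rcases n with _ | _ | n
  · exact (lt_of_head rfl rfl).le
  · exact le_rfl
  · exact le_const_one _

theorem within_zero_ones : Within (cons 0 (const 1)) (const 1) (evConst [0] 1) := by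
  rw [evConst_eq_app]
  intro n
  refine ⟨?_, le_const_one _⟩
  rcases n with _ | n
  · exact le_rfl
  · exact le_const_one _

theorem L_const_one_eq : Gen.L.onWord (const 1) = Gen.M.onWord (const 0) := by
  refine eq_of_forall_agree fun N => ?_
  induction N using Nat.strong_induction_on with
  | _ N ih =>
    rcases N with _ | _ | N
    · exact agree_zero _ _
    · exact agree_one (by rw [M_const_zero, onWord_L_head]; rfl)
    · rw [M_const_zero, ← cons_const 1, onWord_L_one, agree_cons_iff, agree_cons_iff]
      exact ih N (by omega)

theorem M_const_one_eq : Gen.M.onWord (const 1) = cons 1 (Gen.M.onWord (const 0)) := by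
  refine eq_of_forall_agree fun N => ?_
  induction N using Nat.strong_induction_on with
  | _ N ih =>
    rcases N with _ | _ | N
    · exact agree_zero _ _
    · exact agree_one (by rw [M_const_one]; rfl)
    · rw [M_const_one, M_const_zero, agree_cons_iff, agree_cons_iff]
      exact ih N (by omega)

theorem R_const_zero_eq : Gen.R.onWord (const 0) = Gen.M.onWord (const 0) := by
  refine eq_of_forall_agree fun N => ?_
  induction N using Nat.strong_induction_on with
  | _ N ih =>
    rcases N with _ | _ | N
    · exact agree_zero _ _
    · exact agree_one (by rw [M_const_zero, ← cons_const, onWord_R_zero]; rfl)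
    · rw [M_const_zero, ← cons_const 0, onWord_R_zero, agree_cons_iff, agree_cons_iff, cons_const]
      exact ih N (by omega)

theorem M_zero_ones : Gen.M.onWord (evConst [0] 1) = Gen.R.onWord (evConst [0, 1] 0) := by
  simp only [evConst_eq_app, app_cons, app_nil, onWord_M_zero, onWord_R_zero, onWord_R_one,
    M_const_one_eq, R_const_zero_eq]

theorem extremal_M_one_zeros :
    Extremal (lo .L (cons 0 (const 1))) (hi .L (const 1)) (Gen.M.onWord (evConst [1] 0)) := by
  have e1 : lo .L (cons 0 (const 1)) = cons 0 (Gen.M.onWord (const 0)) := by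
    rw [lo, onWord_L_zero, L_const_one_eq]
  have e2 : hi .L (const 1) = cons 1 (Gen.M.onWord (const 0)) := by
    rw [← cons_const, hi_L_cons, L_const_one_eq]
  have e3 : Gen.M.onWord (evConst [1] 0) = cons 1 (cons 0 (Gen.M.onWord (const 0))) := by
    rw [evConst_eq_app, app_cons, app_nil, onWord_M_one]
  rw [e1, e2, e3]
  set z := Gen.M.onWord (const 0) with hz
  have hzz : z = cons 0 (cons 1 z) := M_const_zero
  have hw : Within (cons 0 z) (cons 1 z) z := by
    have : ∀ n, drop n z = z ∨ drop n z = cons 1 z := by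
      intro n
      induction n with
      | zero => exact Or.inl rfl
      | succ n ih =>
        rw [add_comm, ← drop_drop]
        rcases ih with h | h <;> rw [h]
        · right; rw [hzz, drop_one_cons, ← hzz]
        · left; rw [drop_one_cons]
    intro n
    rcases this n with h | h <;> rw [h]
    · exact ⟨cons_zero_le _, le_cons_one _⟩
    · exact ⟨(lt_of_head rfl rfl).le, le_rfl⟩
  refine ⟨?_, rfl, rfl, ⟨0, rfl, rfl⟩, ⟨2, ?_, ?_⟩⟩
  · rintro (_ | _ | n)
    · exact ⟨(lt_of_head rfl rfl).le, cons_le_cons.2 (cons_zero_le _)⟩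
    · exact ⟨le_rfl, (lt_of_head rfl rfl).le⟩
    · exact hw n
  · rw [hzz]; rfl
  · rw [hzz]
    change cons 1 z = cons 1 (cons 0 (cons 1 z))
    rw [← hzz]

/-- The left plateau: the pairs at its ends have the same first component. -/
theorem lo_L_eq_lo_M : lo .L (cons 0 (const 1)) = lo .M (const 0) := by
  rw [lo, lo, onWord_L_zero, L_const_one_eq]

theorem hi_L_le_hi_M : hi .L (const 1) ≼ hi .M (cons 1 (const 0)) := by
  rw [← cons_const, hi_L_cons, L_const_one_eq, hi, cons_le_cons]
  exact onWord_le .M (const_zero_le _)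

/-- The right plateau: the pairs at its ends have the same second component. -/
theorem hi_M_eq_hi_R : hi .M (const 1) = hi .R (cons 1 (const 0)) := by
  rw [hi, hi, onWord_R_one, M_const_one_eq, R_const_zero_eq]

/-! ### Products of substitutions -/

theorem hiList_le {σ : List Gen} {u v : Word} (h : u ≼ v) : hiList σ u ≼ hiList σ v := by
  induction σ with
  | nil => exact h
  | cons s σ ih => exact not_lt.1 fun h' => absurd ih (not_le.2 ((hi_lt_iff s).1 h'))

theorem exists_drop_listOnWord (σ : List Gen) (u : Word) (k : ℕ) :
    ∃ n, k ≤ n ∧ drop n (listOnWord σ u) = listOnWord σ (drop k u) := by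
  induction σ with
  | nil => exact ⟨k, le_rfl, rfl⟩
  | cons s σ ih =>
    obtain ⟨n, hn, e⟩ := ih
    obtain ⟨p, hp, e'⟩ := exists_drop_onWord s (listOnWord σ u) n
    exact ⟨p, by omega, by rw [listOnWord_cons, e', e, listOnWord_cons]⟩

theorem onWord_app (s : Gen) (l : List (Fin 2)) (u : Word) :
    s.onWord (app l u) = app (s.onList l) (s.onWord u) := by
  induction l with
  | nil => rfl
  | cons a l ih => rw [app_cons, onWord_cons, ih, onList_cons, app_append]

theorem listOnWord_app (σ : List Gen) (l : List (Fin 2)) (u : Word) :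
    listOnWord σ (app l u) = app (listOnList σ l) (listOnWord σ u) := by
  induction σ with
  | nil => rfl
  | cons s σ ih => rw [listOnWord_cons, ih, onWord_app]; rfl

theorem listOnWord_lt (σ : List Gen) {u v : Word} (h : u ≺ v) :
    listOnWord σ u ≺ listOnWord σ v := by
  induction σ with
  | nil => exact h
  | cons s σ ih => exact onWord_lt s ih

/-- The images of both letters under the product of `σ` contain both letters. -/
def Full (σ : List Gen) : Prop := ∀ a b : Fin 2, b ∈ listOnList σ [a]

theorem Full.cons {σ : List Gen} (h : Full σ) (s : Gen) : Full (s :: σ) := by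
  intro a b
  have : b ∈ s.letter 0 ∨ b ∈ s.letter 1 := by
    rcases fin2_cases b with rfl | rfl <;> cases s <;> simp [Gen.letter]
  rcases this with hb | hb
  · exact List.mem_flatMap.2 ⟨0, h a 0, hb⟩
  · exact List.mem_flatMap.2 ⟨1, h a 1, hb⟩

theorem Full.append_left {σ : List Gen} (h : Full σ) (τ : List Gen) : Full (τ ++ σ) := by
  induction τ with
  | nil => exact h
  | cons s τ ih => exact ih.cons s

theorem full_pair {s t : Gen} (hL : ¬(s = .L ∧ t = .L)) (hR : ¬(s = .R ∧ t = .R)) :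
    Full [s, t] := by
  intro a b
  rcases fin2_cases a with rfl | rfl <;> rcases fin2_cases b with rfl | rfl <;>
    cases s <;> cases t <;> simp_all [listOnList, Gen.onList, Gen.letter]

theorem Full.exists_letter {σ : List Gen} (h : Full σ) (u : Word) (N : ℕ) (b : Fin 2) :
    ∃ i, N ≤ i ∧ listOnWord σ u i = b := by
  obtain ⟨p, hp, e⟩ := exists_drop_listOnWord σ u N
  obtain ⟨j, hj, hb⟩ := List.getElem_of_mem (h (u N) b)
  refine ⟨j + p, by omega, ?_⟩
  have : drop p (listOnWord σ u) j = b := by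
    rw [e, ← cons_drop u N, ← app_nil (drop (N + 1) u), ← app_cons, listOnWord_app,
      app_apply_lt _ _ hj, List.getD_eq_getElem _ _ hj, hb]
  exact this

theorem exists_change {u : Word} (h : ∀ N b, ∃ i, N ≤ i ∧ u i = b) (a b : Fin 2) (hab : a ≠ b) :
    ∃ k, u k = a ∧ u (k + 1) = b := by
  by_contra hc
  push Not at hc
  obtain ⟨i, -, hi'⟩ := h 0 a
  have : ∀ d, u (i + d) = a := by
    intro d
    induction d with
    | zero => exact hi'
    | succ d ih => have := hc _ ih; rw [← add_assoc]; omega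
  obtain ⟨j, hj, e⟩ := h i b
  obtain ⟨d, rfl⟩ := Nat.exists_eq_add_of_le hj
  exact hab ((this d).symm.trans e)

/-! ### Limit words -/

/-- The first `n` substitutions of the sequence `s`. -/
def pre (s : ℕ → Gen) (n : ℕ) : List Gen := (List.range n).map s

/-- The substitutions `s n, …, s (n + k - 1)`. -/
def seg (s : ℕ → Gen) (n k : ℕ) : List Gen := (List.range' n k).map s

theorem pre_succ (s : ℕ → Gen) (n : ℕ) : pre s (n + 1) = pre s n ++ [s n] := by
  simp [pre, List.range_succ]

theorem length_pre (s : ℕ → Gen) (n : ℕ) : (pre s n).length = n := by simp [pre]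

theorem seg_succ (s : ℕ → Gen) (n k : ℕ) : seg s n (k + 1) = s n :: seg s (n + 1) k := by
  simp [seg, List.range'_succ]

theorem seg_add (s : ℕ → Gen) (n k j : ℕ) : seg s n (k + j) = seg s n k ++ seg s (n + k) j := by
  rw [seg, seg, seg, ← List.map_append, List.range'_append_1]

theorem limit_eq_seg {s : ℕ → Gen} {v : ℕ → Word} (hv : ∀ n, v n = (s n).onWord (v (n + 1)))
    (n k : ℕ) : v n = listOnWord (seg s n k) (v (n + k)) := by
  induction k generalizing n with
  | zero => rfl
  | succ k ih => rw [seg_succ, listOnWord_cons, hv n, ih (n + 1), add_right_comm, add_assoc]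

theorem pre_eq_seg (s : ℕ → Gen) (n : ℕ) : pre s n = seg s 0 n := by
  simp [pre, seg, List.range_eq_range']

theorem agree_onWord_of_head (s : Gen) {k : ℕ} {u v : Word} (hu : u 0 = 0)
    (h : Agree (k + 1) u v) : Agree (k + 2) (s.onWord u) (s.onWord v) := by
  cases s
  · exact agree_lo .L hu h
  · have hv : v 0 = 0 := by rw [← h 0 (by omega), hu]
    obtain ⟨u, rfl⟩ := exists_cons_of_head hu
    obtain ⟨v, rfl⟩ := exists_cons_of_head hv
    rw [onWord_M_zero, onWord_M_zero, agree_cons_iff, agree_cons_iff]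
    exact agree_onWord .M (agree_cons_iff.1 h)
  · exact agree_lo .R hu h

theorem listOnWord_head_zero (σ : List Gen) {u : Word} (h : u 0 = 0) : listOnWord σ u 0 = 0 := by
  induction σ with
  | nil => exact h
  | cons s σ ih => exact onWord_head_zero s ih

theorem agree_listOnWord_of_head (σ : List Gen) {u v : Word} (hu : u 0 = 0) (hv : v 0 = 0) :
    Agree (σ.length + 1) (listOnWord σ u) (listOnWord σ v) := by
  induction σ with
  | nil => exact agree_one (hu.trans hv.symm)
  | cons s σ ih => exact agree_onWord_of_head s (listOnWord_head_zero σ hu) ih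

theorem exists_limitWord (s : ℕ → Gen) : ∃ u, IsLimitWord s u := by
  let v : ℕ → Word := fun n i => listOnWord (seg s n i) (const 0) i
  have hv : ∀ n k, Agree (k + 1) (v n) (listOnWord (seg s n k) (const 0)) := by
    intro n k i hi'
    obtain ⟨j, rfl⟩ := Nat.exists_eq_add_of_le (Nat.lt_succ_iff.1 hi')
    rw [seg_add, listOnWord_append]
    refine agree_listOnWord_of_head (seg s n i) rfl (listOnWord_head_zero _ rfl) i ?_
    simp [seg]
  refine ⟨v 0, v, rfl, fun n => eq_of_forall_agree fun k => ?_⟩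
  have h1 := hv n (k + 1)
  have h2 := agree_onWord (s n) (hv (n + 1) k)
  rw [seg_succ, listOnWord_cons] at h1
  exact (h1.mono (by omega)).trans (h2.symm.mono (by omega))

/-- For a limit word `u` of a primitive sequence, `infO u` and `supO u` are limits of the images
of all words that begin with `0` and `1`. The reason is that the word in position `n` of the
sequence contains `10` and `01`, so that images of such words occur as tails of `u`; the last
part of the conclusion is such an occurrence. -/
theorem IsPrimitive.agree {s : ℕ → Gen} (hs : IsPrimitive s) {u : Word} (hu : IsLimitWord s u)
    (n : ℕ) {x y : Word} (hx : x 0 = 0) (hy : y 0 = 1) :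
    Agree (n + 1) (infO u) (loList (pre s n) x) ∧
      Agree (n + 1) (supO u) (hiList (pre s n) y) ∧
      ∃ k y', y' 0 = 1 ∧ drop k u = hiList (pre s n) y' := by
  obtain ⟨v, rfl, hv⟩ := hu
  obtain ⟨p, hp, hfull⟩ := hs n
  have hvn : v 0 = listOnWord (pre s n) (v n) := by
    rw [pre_eq_seg, limit_eq_seg hv 0 n, zero_add]
  have hlet : ∀ N b, ∃ i, N ≤ i ∧ v n i = b := by
    intro N b
    rw [limit_eq_seg hv n (p + 1 - n)]
    exact Full.exists_letter hfull _ N b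
  obtain ⟨i, hi1, hi0⟩ := exists_change hlet 1 0 (by decide)
  obtain ⟨j, hj0, hj1⟩ := exists_change hlet 0 1 (by decide)
  obtain ⟨k, -, hk⟩ := exists_lo_tail_list (pre s n) hi1
  obtain ⟨l, -, hl⟩ := exists_hi_tail_list (pre s n) hj0
  rw [← hvn] at hk hl
  have hw := (within_const (v n)).listOnWord rfl rfl (pre s n)
  rw [← hvn] at hw
  have hlen := length_pre s n
  refine ⟨?_, ?_, l + 1, _, by simpa using hj1, hl⟩
  · have h1 := agree_loList_of_head (pre s n) (u := const 0) (v := drop (i + 1) (v n)) rfl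
      (by simpa using hi0)
    rw [← hk] at h1
    have h2 := h1.of_between (le_infO fun n => (hw n).1) (infO_le (v 0) (k + 1))
    rw [hlen] at h2
    refine h2.symm.trans ?_
    have := agree_loList_of_head (pre s n) (u := const 0) rfl hx
    rwa [hlen] at this
  · have h1 := agree_hiList_of_head (pre s n) (u := drop (j + 1) (v n)) (v := const 1)
      (by simpa using hj1) rfl
    rw [← hl] at h1
    have h2 := h1.of_between (le_supO (v 0) (l + 1)) (supO_le fun n => (hw n).2)
    rw [hlen] at h2 h1
    refine h2.symm.trans (h1.trans ?_)
    have := agree_hiList_of_head (pre s n) (u := const 1) rfl hy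
    rwa [hlen] at this

theorem IsPrimitive.approx {s : ℕ → Gen} (hs : IsPrimitive s) {u : Word}
    (hu : IsLimitWord s u) : Approx (infO u) (supO u) := by
  intro N
  refine ⟨pre s N, fun x y hx hy => ?_⟩
  obtain ⟨h1, h2, -⟩ := hs.agree hu N hx hy
  exact ⟨h1.mono (by omega), h2.mono (by omega)⟩

theorem IsPrimitive.supO_head {s : ℕ → Gen} (hs : IsPrimitive s) {u : Word}
    (hu : IsLimitWord s u) : supO u 0 = 1 :=
  (hs.agree hu 0 (x := const 0) (y := const 1) rfl rfl).2.1 0 (by omega)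

theorem IsPrimitive.infO_le_tail {s : ℕ → Gen} (hs : IsPrimitive s) {u : Word}
    (hu : IsLimitWord s u) : infO u ≼ drop 1 (supO u) := by
  by_contra h
  obtain ⟨i, hi', h0, h1⟩ := lexLt_iff.1 (not_le.1 h)
  obtain ⟨-, -, k, y, hy, e⟩ := hs.agree hu (i + 1) (x := const 0) (y := const 1) rfl rfl
  have hag := (hs.agree hu (i + 1) (x := const 0) (y := y) rfl hy).2.1
  rw [← e] at hag
  -- the tail `drop (k + 1) u` agrees with the tail of `supO u` on `i + 1` letters
  have hd : ∀ j ≤ i, drop 1 (drop k u) j = drop 1 (supO u) j := fun j hj =>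
    (hag (j + 1) (by omega)).symm
  refine absurd (infO_le u (1 + k)) (not_le.2 (lexLt_iff.2 ⟨i, ?_, ?_, h1⟩))
  · rw [← drop_drop]
    exact fun j hj => (hd j hj.le).trans (hi' j hj)
  · rw [← drop_drop, hd i le_rfl, h0]

theorem IsPrimitive.twoOnes {s : ℕ → Gen} (hs : IsPrimitive s) {u : Word}
    (hu : IsLimitWord s u) : TwoOnes u := by
  obtain ⟨v, rfl, hv⟩ := hu
  obtain ⟨p, hp, hfull⟩ := hs 0
  have hlet : ∀ N b, ∃ i, N ≤ i ∧ v 0 i = b := by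
    intro N b
    rw [limit_eq_seg hv 0 (p + 1)]
    exact Full.exists_letter hfull _ N b
  obtain ⟨i, -, hi'⟩ := hlet 0 1
  obtain ⟨j, hj, hj'⟩ := hlet (i + 1) 1
  exact ⟨i, j, by omega, hi', hj'⟩

theorem twoOnes_M (τ : List Gen) (u : Word) : TwoOnes (listOnWord τ (Gen.M.onWord u)) := by
  have hfull : Full (τ ++ [.M]) := by
    refine Full.append_left (fun a b => ?_) τ
    rcases fin2_cases a with rfl | rfl <;> rcases fin2_cases b with rfl | rfl <;>
      simp [listOnList, Gen.onList, Gen.letter]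
  have hlet := hfull.exists_letter u
  rw [listOnWord_append, listOnWord_cons, listOnWord_nil] at hlet
  obtain ⟨i, -, hi'⟩ := hlet 0 1
  obtain ⟨j, hj, hj'⟩ := hlet (i + 1) 1
  exact ⟨i, j, by omega, hi', hj'⟩

/-- A sequence of substitutions that is not primitive is eventually constant. -/
theorem eventually_of_not_isPrimitive {s : ℕ → Gen} (h : ¬IsPrimitive s) :
    ∃ k, (∀ n, k ≤ n → s n = .L) ∨ ∀ n, k ≤ n → s n = .R := by
  unfold IsPrimitive at h
  push Not at h
  obtain ⟨k, hk⟩ := h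
  have hpair : ∀ n, k ≤ n → (s n = .L ∧ s (n + 1) = .L) ∨ (s n = .R ∧ s (n + 1) = .R) := by
    intro n hn
    by_contra hc
    push Not at hc
    have hf := (full_pair (s := s n) (t := s (n + 1)) (fun h => hc.1 h.1 h.2)
      (fun h => hc.2 h.1 h.2)).append_left (seg s k (n - k))
    have e : seg s k (n - k) ++ [s n, s (n + 1)] = seg s k (n + 1 + 1 - k) := by
      rw [show n + 1 + 1 - k = (n - k) + 2 by omega, seg_add, show k + (n - k) = n by omega]
      rfl
    rw [e] at hf
    obtain ⟨a, b, hab⟩ := hk (n + 1) (by omega)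
    exact hab (hf a b)
  refine ⟨k, ?_⟩
  rcases hpair k le_rfl with ⟨h, -⟩ | ⟨h, -⟩
  · left
    intro n hn
    induction n, hn using Nat.le_induction with
    | base => exact h
    | succ n hn ih => rcases hpair n hn with h' | h' <;> simp_all
  · right
    intro n hn
    induction n, hn using Nat.le_induction with
    | base => exact h
    | succ n hn ih => rcases hpair n hn with h' | h' <;> simp_all

/-! ### Values of digit sequences -/

theorem summable_val {x D : ℝ} (hx : 1 < x) {d : ℕ → ℝ} (h0 : ∀ k, 0 ≤ d k)
    (hD : ∀ k, d k ≤ D) : Summable fun k => d k / x ^ (k + 1) := by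
  have hx0 : 0 < x := by linarith
  have hg : Summable fun k : ℕ => D * (1 / x) * (1 / x) ^ k :=
    (summable_geometric_of_lt_one (by positivity) ((div_lt_one hx0).2 hx)).mul_left _
  refine hg.of_nonneg_of_le (fun k => div_nonneg (h0 k) (by positivity)) fun k => ?_
  rw [mul_assoc, ← pow_succ', one_div, inv_pow, ← div_eq_mul_inv]
  gcongr
  exact hD k

theorem summable_val_tail {x : ℝ} (hx : 0 < x) {d : ℕ → ℝ}
    (hs : Summable fun k => d k / x ^ (k + 1)) :
    Summable fun k => d (k + 1) / x ^ (k + 1) := by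
  have := ((summable_nat_add_iff 1).2 hs).mul_left x
  refine this.congr fun k => ?_
  field_simp
  ring

theorem mul_val {x : ℝ} (hx : 0 < x) {d : ℕ → ℝ}
    (hs : Summable fun k => d k / x ^ (k + 1)) :
    x * val x d = d 0 + val x fun k => d (k + 1) := by
  rw [val, hs.tsum_eq_zero_add, mul_add, val, ← tsum_mul_left]
  congr 1
  · field_simp
    ring
  · congr 1
    funext k
    field_simp
    ring

theorem val_nonneg {x : ℝ} (hx : 0 ≤ x) {d : ℕ → ℝ} (h0 : ∀ k, 0 ≤ d k) : 0 ≤ val x d :=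
  tsum_nonneg fun k => div_nonneg (h0 k) (by positivity)

theorem val_const {x : ℝ} (hx : 1 < x) (D : ℝ) : val x (fun _ => D) = D / (x - 1) := by
  have hx0 : 0 < x := by linarith
  have h : ∀ k : ℕ, D / x ^ (k + 1) = D * (1 / x) * (1 / x) ^ k := fun k => by
    rw [mul_assoc, ← pow_succ', one_div, inv_pow, ← div_eq_mul_inv]
  have hx1 : x - 1 ≠ 0 := by linarith
  rw [val, tsum_congr h, tsum_mul_left,
    tsum_geometric_of_lt_one (by positivity) ((div_lt_one hx0).2 hx)]
  field_simp

theorem val_mono {x D : ℝ} (hx : 1 < x) {d e : ℕ → ℝ} (h0 : ∀ k, 0 ≤ d k)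
    (hde : ∀ k, d k ≤ e k) (hD : ∀ k, e k ≤ D) : val x d ≤ val x e := by
  have hx0 : 0 < x := by linarith
  refine (summable_val hx h0 fun k => (hde k).trans (hD k)).tsum_le_tsum (fun k => ?_)
    (summable_val hx (fun k => (h0 k).trans (hde k)) hD)
  gcongr
  exact hde k

theorem val_le {x D : ℝ} (hx : 1 < x) {d : ℕ → ℝ} (h0 : ∀ k, 0 ≤ d k) (hD : ∀ k, d k ≤ D) :
    val x d ≤ D / (x - 1) := by
  rw [← val_const hx]
  exact val_mono hx h0 hD fun _ => le_rfl

/-- The map `x ↦ x π_x(d)` is non-increasing where the series converges. -/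
theorem mul_val_le {x y : ℝ} (hx : 0 < x) (hxy : x ≤ y) {d : ℕ → ℝ} (h0 : ∀ k, 0 ≤ d k)
    (hs : Summable fun k => d k / x ^ (k + 1)) :
    (Summable fun k => d k / y ^ (k + 1)) ∧ y * val y d ≤ x * val x d := by
  have hy : 0 < y := hx.trans_le hxy
  have hle : ∀ k, d k / y ^ (k + 1) ≤ d k / x ^ (k + 1) := fun k =>
    div_le_div_of_nonneg_left (h0 k) (by positivity) (by gcongr)
  have hsy := hs.of_nonneg_of_le (fun k => div_nonneg (h0 k) (by positivity)) hle
  refine ⟨hsy, ?_⟩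
  rw [val, val, ← tsum_mul_left, ← tsum_mul_left]
  refine (hsy.mul_left y).tsum_le_tsum (fun k => ?_) (hs.mul_left x)
  have e : ∀ z : ℝ, 0 < z → z * (d k / z ^ (k + 1)) = d k / z ^ k := fun z hz => by
    field_simp
    ring
  rw [e y hy, e x hx]
  exact div_le_div_of_nonneg_left (h0 k) (by positivity) (by gcongr)

theorem continuousOn_val {D : ℝ} {d : ℕ → ℝ} (h0 : ∀ k, 0 ≤ d k) (hD : ∀ k, d k ≤ D) :
    ContinuousOn (fun x => val x d) (Set.Ioi 1) := by
  intro x hx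
  have hx' : 1 < (1 + x) / 2 := by have : (1 : ℝ) < x := hx; linarith
  have hxx : (1 + x) / 2 < x := by have : (1 : ℝ) < x := hx; linarith
  have hc : ContinuousOn (fun x => val x d) (Set.Ioi ((1 + x) / 2)) := by
    unfold val
    refine continuousOn_tsum (fun k => ?_) (summable_val hx' h0 hD) ?_
    · refine continuousOn_const.div (by fun_prop) fun y hy => ?_
      have : (1 + x) / 2 < y := hy
      have : 0 < y := by linarith
      positivity
    · intro k y hy
      have hy' : (1 + x) / 2 < y := hy
      have : 0 < y := by linarith
      rw [Real.norm_of_nonneg (div_nonneg (h0 k) (by positivity))]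
      exact div_le_div_of_nonneg_left (h0 k) (by positivity) (by gcongr)
  exact (hc.continuousAt (Ioi_mem_nhds hxx)).continuousWithinAt

/-! ### Values of words -/

/-- The letters of a word as real digits. -/
def dig (u : Word) : ℕ → ℝ := fun k => ((u k : ℕ) : ℝ)

theorem wval_eq (x : ℝ) (u : Word) : wval x u = val x (dig u) := rfl

theorem dig_nonneg (u : Word) (k : ℕ) : 0 ≤ dig u k := Nat.cast_nonneg _

theorem dig_le_one (u : Word) (k : ℕ) : dig u k ≤ 1 := by
  have : (u k : ℕ) ≤ 1 := by omega
  rw [dig]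
  exact_mod_cast this

theorem dig_eq_zero {u : Word} {k : ℕ} (h : u k = 0) : dig u k = 0 := by simp [dig, h]

theorem dig_eq_one {u : Word} {k : ℕ} (h : u k = 1) : dig u k = 1 := by simp [dig, h]

theorem wval_nonneg {x : ℝ} (hx : 0 ≤ x) (u : Word) : 0 ≤ wval x u :=
  val_nonneg hx (dig_nonneg u)

theorem wval_le {x : ℝ} (hx : 1 < x) (u : Word) : wval x u ≤ 1 / (x - 1) :=
  val_le hx (dig_nonneg u) (dig_le_one u)

theorem mul_wval {x : ℝ} (hx : 1 < x) (u : Word) :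
    x * wval x u = dig u 0 + wval x (drop 1 u) :=
  mul_val (by linarith) (summable_val hx (dig_nonneg u) (dig_le_one u))

theorem wval_drop_succ_eq {x : ℝ} (hx : 1 < x) (u : Word) (k : ℕ) :
    x * wval x (drop k u) = dig u k + wval x (drop (k + 1) u) := by
  rw [mul_wval hx, drop_drop, add_comm 1 k]
  congr 1
  simp [dig]

/-- For `x ≥ 2`, the value in base `x` is monotone for the lexicographic order. -/
theorem wval_le_wval {x : ℝ} (hx : 2 ≤ x) {u v : Word} (h : u ≼ v) : wval x u ≤ wval x v := by
  have hx1 : 1 < x := by linarith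
  rcases h.eq_or_lt with e | hlt
  · rw [toLex_inj.1 e]
  obtain ⟨k, hk, h0, h1⟩ := lexLt_iff.1 hlt
  clear h hlt
  induction k generalizing u v with
  | zero =>
    have e1 := mul_wval hx1 u
    have e2 := mul_wval hx1 v
    rw [dig_eq_zero h0] at e1
    rw [dig_eq_one h1] at e2
    have h3 := wval_le hx1 (drop 1 u)
    have h4 := wval_nonneg (x := x) (by linarith) (drop 1 v)
    have h5 : 1 / (x - 1) ≤ 1 := by rw [div_le_one] <;> linarith
    nlinarith
  | succ k ih =>
    have := ih (u := drop 1 u) (v := drop 1 v) (fun i hi => hk (i + 1) (by omega)) h0 h1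
    have e1 := mul_wval hx1 u
    have e2 := mul_wval hx1 v
    have e3 : dig u 0 = dig v 0 := by rw [dig, dig, hk 0 (by omega)]
    nlinarith

theorem lt_of_wval_lt {x : ℝ} (hx : 2 ≤ x) {u v : Word} (h : wval x u < wval x v) : u ≺ v :=
  not_le.1 fun h' => absurd (wval_le_wval hx h') (not_le.2 h)

theorem abs_wval_sub_le {x : ℝ} (hx : 1 < x) {N : ℕ} {u v : Word} (h : Agree N u v) :
    |wval x u - wval x v| ≤ 1 / (x - 1) / x ^ N := by
  have hx0 : 0 < x := by linarith
  induction N generalizing u v with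
  | zero =>
    have h1 := wval_le hx u
    have h2 := wval_le hx v
    have h3 := wval_nonneg hx0.le u
    have h4 := wval_nonneg hx0.le v
    rw [pow_zero, div_one, abs_le]
    constructor <;> linarith
  | succ N ih =>
    have := ih (u := drop 1 u) (v := drop 1 v) (fun i hi => h (i + 1) (by omega))
    have e1 := mul_wval hx u
    have e2 := mul_wval hx v
    have e3 : dig u 0 = dig v 0 := by rw [dig, dig, h 0 (by omega)]
    have e4 : wval x (drop 1 u) - wval x (drop 1 v) = x * (wval x u - wval x v) := by
      rw [mul_sub]; linarith
    rw [e4, abs_mul, abs_of_pos hx0] at this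
    rw [pow_succ, ← div_div, le_div_iff₀ hx0, mul_comm]
    exact this

theorem le_abs_wval_sub {x : ℝ} (hx : 2 < x) {p : ℕ} {u v : Word} (h : Agree p u v)
    (hp : u p ≠ v p) : (x - 2) / (x - 1) / x ^ (p + 1) ≤ |wval x u - wval x v| := by
  have hx1 : 1 < x := by linarith
  have hx0 : 0 < x := by linarith
  induction p generalizing u v with
  | zero =>
    wlog huv : u 0 = 0 generalizing u v
    · rw [abs_sub_comm]
      exact this (agree_zero _ _) (Ne.symm hp) (by omega)
    have hv : v 0 = 1 := by omega
    have e1 := mul_wval hx1 u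
    have e2 := mul_wval hx1 v
    rw [dig_eq_zero huv] at e1
    rw [dig_eq_one hv] at e2
    have h3 := wval_le hx1 (drop 1 u)
    have h4 := wval_nonneg (x := x) (by linarith) (drop 1 v)
    rw [abs_sub_comm]
    refine le_trans ?_ (le_abs_self _)
    rw [zero_add, pow_one, div_le_iff₀ hx0]
    have e5 : (x - 2) / (x - 1) = 1 - 1 / (x - 1) := by
      have : x - 1 ≠ 0 := by linarith
      field_simp; ring
    rw [e5]
    linarith
  | succ p ih =>
    have := ih (u := drop 1 u) (v := drop 1 v) (fun i hi => h (i + 1) (by omega)) hp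
    have e1 := mul_wval hx1 u
    have e2 := mul_wval hx1 v
    have e3 : dig u 0 = dig v 0 := by rw [dig, dig, h 0 (by omega)]
    have e4 : wval x (drop 1 u) - wval x (drop 1 v) = x * (wval x u - wval x v) := by
      rw [mul_sub]; linarith
    rw [e4, abs_mul, abs_of_pos hx0] at this
    rw [pow_succ, ← div_div, div_le_iff₀ hx0, mul_comm |wval x u - wval x v|]
    exact this

/-- The value of a word in a fixed base is continuous in the word. -/
theorem exists_agree_wval_mem {x : ℝ} (hx : 1 < x) {u : Word} {S : Set ℝ} (hS : IsOpen S)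
    (hu : wval x u ∈ S) : ∃ N, ∀ v, Agree N u v → wval x v ∈ S := by
  obtain ⟨ε, hε, hball⟩ := Metric.isOpen_iff.1 hS _ hu
  have hlim : Tendsto (fun N : ℕ => 1 / (x - 1) / x ^ N) atTop (𝓝 0) :=
    tendsto_const_nhds.div_atTop (tendsto_pow_atTop_atTop_of_one_lt hx)
  obtain ⟨N, hN⟩ := (hlim.eventually (gt_mem_nhds hε)).exists
  refine ⟨N, fun v hv => hball ?_⟩
  rw [Metric.mem_ball, Real.dist_eq, abs_sub_comm]
  exact (abs_wval_sub_le hx hv).trans_lt hN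

/-! ### The equations for `f` and `g` -/

/-- The function `x ↦ x π_x(b)`; the equation `F x (sup O(u)) = m` defines `f_u(m)`. -/
noncomputable def F (x : ℝ) (b : Word) : ℝ := x * wval x b

/-- The function `x ↦ (x - 1) (1 + π_x(a))`; the equation `H x (inf O(u)) = m` defines
`g_u(m)`. -/
noncomputable def H (x : ℝ) (a : Word) : ℝ := (x - 1) * (1 + wval x a)

theorem F_eq {x : ℝ} (hx : 1 < x) {b : Word} (hb : b 0 = 1) : F x b = 1 + wval x (drop 1 b) := by
  rw [F, mul_wval hx, dig_eq_one hb]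

theorem mul_wval_le {x y : ℝ} (hx : 1 < x) (hxy : x ≤ y) (u : Word) :
    y * wval y u ≤ x * wval x u :=
  (mul_val_le (by linarith) hxy (dig_nonneg u)
    (summable_val hx (dig_nonneg u) (dig_le_one u))).2

theorem F_lt_of_le {x y m : ℝ} (hx : 1 < x) (hxy : x < y) (hm : 1 < m) {b : Word}
    (hb : b 0 = 1) (h : F x b ≤ m) : F y b < m := by
  rw [F_eq hx hb] at h
  rw [F_eq (hx.trans hxy) hb]
  have h1 := mul_wval_le hx hxy.le (drop 1 b)
  have h2 : x * wval x (drop 1 b) ≤ x * (m - 1) :=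
    mul_le_mul_of_nonneg_left (by linarith) (by linarith)
  have h3 : x * (m - 1) < y * (m - 1) := mul_lt_mul_of_pos_right hxy (by linarith)
  have h4 : y * wval y (drop 1 b) < y * (m - 1) := by linarith
  have := lt_of_mul_lt_mul_left h4 (by linarith)
  linarith

/-- The inequality `m ≤ (x - 1) (1 + π_x(a))` means that `∑ (m - a_k) x⁻ᵏ ≤ 1`, and the
left-hand side of the latter is decreasing in `x` as `m > 1`. -/
theorem lt_H_of_le {x y m : ℝ} (hx : 1 < x) (hxy : x < y) (hm : 1 < m) {a : Word}
    (h : m ≤ H x a) : m < H y a := by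
  have h0 : ∀ k, 0 ≤ m - dig a k := fun k => by linarith [dig_le_one a k]
  have hD : ∀ k, m - dig a k ≤ m := fun k => by linarith [dig_nonneg a k]
  have key : ∀ z, 1 < z → val z (fun k => m - dig a k) = m / (z - 1) - wval z a := by
    intro z hz
    rw [← val_const hz, wval_eq, val, val, val, ← Summable.tsum_sub]
    · congr 1; funext k; rw [sub_div]
    · exact summable_val hz (d := fun _ => m) (fun _ => by linarith) (fun _ => le_rfl)
    · exact summable_val hz (dig_nonneg a) (dig_le_one a)
  have hy : 1 < y := hx.trans hxy
  have h1 := (mul_val_le (by linarith) hxy.le h0 (summable_val hx h0 hD)).2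
  have h2 : val x (fun k => m - dig a k) ≤ 1 := by
    rw [key x hx, sub_le_iff_le_add, div_le_iff₀ (by linarith), mul_comm]
    exact h
  have h3 : val y (fun k => m - dig a k) < 1 := by
    have : y * val y (fun k => m - dig a k) < y * 1 := by
      have : x * val x (fun k => m - dig a k) ≤ x * 1 :=
        mul_le_mul_of_nonneg_left h2 (by linarith)
      linarith
    exact lt_of_mul_lt_mul_left this (by linarith)
  rw [key y hy, sub_lt_iff_lt_add, div_lt_iff₀ (by linarith), mul_comm] at h3
  exact h3

theorem F_lt_iff {x y m : ℝ} (hx : 1 < x) (hy : 1 < y) (hm : 1 < m) {b : Word} (hb : b 0 = 1)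
    (h : F x b = m) : F y b < m ↔ x < y := by
  refine ⟨fun h' => ?_, fun h' => F_lt_of_le hx h' hm hb h.le⟩
  by_contra hc
  rcases (not_lt.1 hc).eq_or_lt with e | e
  · rw [e] at h'; linarith
  · have := F_lt_of_le hy e hm hb h'.le; linarith

theorem lt_F_iff {x y m : ℝ} (hx : 1 < x) (hy : 1 < y) (hm : 1 < m) {b : Word} (hb : b 0 = 1)
    (h : F x b = m) : m < F y b ↔ y < x := by
  refine ⟨fun h' => ?_, fun h' => ?_⟩
  · by_contra hc
    rcases (not_lt.1 hc).eq_or_lt with e | e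
    · rw [← e] at h'; linarith
    · have := F_lt_of_le hx e hm hb h.le; linarith
  · by_contra hc
    have := F_lt_of_le hy h' hm hb (not_lt.1 hc); linarith

theorem lt_H_iff {x y m : ℝ} (hx : 1 < x) (hy : 1 < y) (hm : 1 < m) {a : Word}
    (h : H x a = m) : m < H y a ↔ x < y := by
  refine ⟨fun h' => ?_, fun h' => lt_H_of_le hx h' hm h.ge⟩
  by_contra hc
  rcases (not_lt.1 hc).eq_or_lt with e | e
  · rw [e] at h'; linarith
  · have := lt_H_of_le hy e hm h'.le; linarith

theorem H_lt_iff {x y m : ℝ} (hx : 1 < x) (hy : 1 < y) (hm : 1 < m) {a : Word}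
    (h : H x a = m) : H y a < m ↔ y < x := by
  refine ⟨fun h' => ?_, fun h' => ?_⟩
  · by_contra hc
    rcases (not_lt.1 hc).eq_or_lt with e | e
    · rw [← e] at h'; linarith
    · have := lt_H_of_le hx e hm h.ge; linarith
  · by_contra hc
    have := lt_H_of_le hy h' hm (not_lt.1 hc); linarith

theorem H_le_self {x : ℝ} (hx : 1 < x) (a : Word) : H x a ≤ x := by
  have h := wval_le hx a
  rw [le_div_iff₀ (by linarith)] at h
  rw [H]; nlinarith

theorem F_le {x : ℝ} (hx : 1 < x) (b : Word) : F x b ≤ 1 + 1 / (x - 1) := by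
  have h := wval_le hx b
  have hx1 : x - 1 ≠ 0 := by linarith
  have e : 1 + 1 / (x - 1) = x * (1 / (x - 1)) := by field_simp; ring
  rw [F, e]
  exact mul_le_mul_of_nonneg_left h (by linarith)

theorem continuousOn_F (b : Word) : ContinuousOn (fun x => F x b) (Set.Ioi 1) :=
  continuousOn_id.mul (continuousOn_val (dig_nonneg b) (dig_le_one b))

theorem continuousOn_H (a : Word) : ContinuousOn (fun x => H x a) (Set.Ioi 1) :=
  (continuousOn_id.sub continuousOn_const).mul
    (continuousOn_const.add (continuousOn_val (dig_nonneg a) (dig_le_one a)))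

theorem H_one_add_ge {m : ℝ} (hm : 1 < m) (a : Word) : m ≤ H (1 + m) a := by
  have := wval_nonneg (x := 1 + m) (by linarith) a
  rw [H]; nlinarith

theorem exists_H_eq {m : ℝ} (hm : 1 < m) (a : Word) : ∃ x, m ≤ x ∧ x ≤ 1 + m ∧ H x a = m := by
  have hc : ContinuousOn (fun x => H x a) (Set.Icc m (1 + m)) :=
    (continuousOn_H a).mono fun x hx => lt_of_lt_of_le hm hx.1
  obtain ⟨x, hx, e⟩ := intermediate_value_Icc (by linarith) hc
    ⟨H_le_self hm a, H_one_add_ge hm a⟩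
  exact ⟨x, hx.1, hx.2, e⟩

theorem one_lt_of_isG {u : Word} {m x : ℝ} (hm : 1 < m) (h : IsG u m x) : 1 < x := by
  by_contra hx
  have h1 := wval_nonneg h.1.le (infO u)
  have h2 := h.2
  nlinarith

theorem existsUnique_isG (u : Word) {m : ℝ} (hm : 1 < m) : ∃! x, IsG u m x := by
  obtain ⟨x, hx, -, e⟩ := exists_H_eq hm (infO u)
  refine ⟨x, ⟨by linarith, e⟩, fun y hy => ?_⟩
  have hy1 := one_lt_of_isG hm hy
  have hx1 : 1 < x := by linarith
  rcases lt_trichotomy y x with h | h | h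
  · exact absurd hy.2 ((H_lt_iff hx1 hy1 hm e).2 h).ne
  · exact h
  · exact absurd hy.2 ((lt_H_iff hx1 hy1 hm e).2 h).ne'

theorem g_eq {u : Word} {m x : ℝ} (hm : 1 < m) (h : IsG u m x) : g u m = x :=
  (existsUnique_isG u hm).unique (Classical.epsilon_spec (p := IsG u m) ⟨x, h⟩) h

theorem TwoOnes.supO {u : Word} (h : TwoOnes u) :
    supO u 0 = 1 ∧ ∃ k, supO u (k + 1) = 1 := by
  wlog hij : ∃ i j : ℕ, i < j ∧ u i = 1 ∧ u j = 1
  · obtain ⟨i, j, hne, hi', hj⟩ := h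
    rcases lt_or_gt_of_ne hne with h | h
    · exact absurd ⟨i, j, h, hi', hj⟩ hij
    · exact absurd ⟨j, i, h, hj, hi'⟩ hij
  obtain ⟨i, j, hlt, hi', hj⟩ := hij
  have hle := le_supO u i
  have h0 : TMS.supO u 0 = 1 := by
    by_contra hc
    exact absurd hle (not_le.2 (lt_of_head (by omega) (by simpa using hi')))
  refine ⟨h0, ?_⟩
  by_contra! hc
  obtain ⟨d, rfl⟩ := Nat.exists_eq_add_of_le (show i + 1 ≤ j from hlt)
  have e : TMS.supO u = cons 1 (const 0) := by
    rw [← cons_drop_one (TMS.supO u), h0]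
    congr 1
    funext k
    have := hc k
    simp only [drop_apply, const_apply]; omega
  rw [e, ← cons_drop u i, hi', cons_le_cons] at hle
  have e' := le_antisymm hle (const_zero_le _)
  have := congrFun (toLex_inj.1 e') d
  simp only [drop_apply, const_apply] at this
  rw [add_comm, this] at hj
  omega

theorem le_wval_of_ones {x : ℝ} (hx : 1 < x) (u : Word) (s : Finset ℕ) (hs : ∀ k ∈ s, u k = 1) :
    ∑ k ∈ s, 1 / x ^ (k + 1) ≤ wval x u := by
  have := (summable_val hx (dig_nonneg u) (dig_le_one u)).sum_le_tsum s
    fun k _ => div_nonneg (dig_nonneg u k) (by positivity)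
  refine le_trans (le_of_eq (Finset.sum_congr rfl fun k hk => ?_)) this
  rw [dig_eq_one (hs k hk)]

theorem exists_lt_F_of_ones {b : Word} (hb : b 0 = 1) (s : Finset ℕ)
    (hs : ∀ k ∈ s, b (k + 1) = 1) {φ : ℝ → ℝ} (hφ : ContinuousAt φ 1) (h : φ 1 < 1 + s.card)
    (ε : ℝ) (hε : 0 < ε) :
    ∃ x, 1 < x ∧ x < 1 + ε ∧ φ x < F x b := by
  have hc : ContinuousAt (fun x : ℝ => 1 + ∑ k ∈ s, 1 / x ^ (k + 1) - φ x) 1 := by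
    refine ((continuousAt_const).add (tendsto_finsetSum _ fun k _ => ?_)).sub hφ
    exact continuousAt_const.div (by fun_prop) (by simp)
  have hpos : (0 : ℝ) < 1 + ∑ k ∈ s, 1 / (1 : ℝ) ^ (k + 1) - φ 1 := by
    simp; linarith
  have h1 := (hc.eventually (lt_mem_nhds hpos)).filter_mono (nhdsWithin_le_nhds (s := Set.Ioi 1))
  have h2 : ∀ᶠ x : ℝ in 𝓝[>] 1, x < 1 + ε :=
    (Iio_mem_nhds (by linarith : (1 : ℝ) < 1 + ε) |> fun h => nhdsWithin_le_nhds h)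
  obtain ⟨x, ⟨hx1, hx2⟩, hx3⟩ := ((h1.and h2).and self_mem_nhdsWithin).exists
  have hx3' : 1 < x := hx3
  refine ⟨x, hx3', hx2, ?_⟩
  rw [F_eq hx3' hb]
  have := le_wval_of_ones hx3' (drop 1 b) s (by simpa using hs)
  linarith

theorem exists_F_eq {m : ℝ} (hm : 1 < m) (hm2 : m ≤ 2) {b : Word} (hb : b 0 = 1) {k : ℕ}
    (hk : b (k + 1) = 1) : ∃ x, 0 < x ∧ F x b = m := by
  have hm1 : m - 1 ≠ 0 := by linarith
  have key : ∀ s : Finset ℕ, (∀ k ∈ s, b (k + 1) = 1) → m < 1 + s.card →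
      ∃ x, 0 < x ∧ F x b = m := by
    intro s hs hcard
    obtain ⟨x, hx, hx', hF⟩ := exists_lt_F_of_ones hb s hs (φ := fun _ => m)
      continuousAt_const hcard (1 / (m - 1)) (div_pos one_pos (by linarith))
    have hc : ContinuousOn (fun x => F x b) (Set.Icc x (1 + 1 / (m - 1))) :=
      (continuousOn_F b).mono fun y hy => lt_of_lt_of_le hx hy.1
    have h2 : F (1 + 1 / (m - 1)) b ≤ m := by
      have := F_le (x := 1 + 1 / (m - 1)) (by linarith) b
      rw [add_sub_cancel_left, one_div_one_div] at this
      linarith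
    obtain ⟨y, hy, e⟩ := intermediate_value_Icc' hx'.le hc ⟨h2, hF.le⟩
    exact ⟨y, by linarith [hy.1], e⟩
  rcases hm2.lt_or_eq with hlt | rfl
  · exact key {k} (by simpa using hk) (by simp; linarith)
  by_cases h3 : ∃ j, j ≠ k ∧ b (j + 1) = 1
  · obtain ⟨j, hjk, hj⟩ := h3
    refine key {j, k} (by simp [hj, hk]) ?_
    rw [Finset.card_pair hjk]; norm_num
  -- two ones only: the solution for `m = 2` is `x = 1`, and the series is a finite sum
  · push Not at h3
    refine ⟨1, one_pos, ?_⟩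
    rw [F, one_mul, wval_eq, val, tsum_eq_sum (s := {0, k + 1})]
    · rw [Finset.sum_pair (by omega), dig_eq_one hb, dig_eq_one hk]; norm_num
    · intro i hi'
      simp only [Finset.mem_insert, Finset.mem_singleton, not_or] at hi'
      obtain ⟨i, rfl⟩ := Nat.exists_eq_succ_of_ne_zero hi'.1
      have := h3 i (by omega)
      rw [dig_eq_zero (by rw [Nat.succ_eq_add_one]; omega), zero_div]

/-- The equation `x π_x(b) = m` has at most one positive solution. For `x ≤ 1` the series may
diverge, but then its junk value `0` is not a solution. -/
theorem F_lt_of_eq {m x y : ℝ} (hm : 1 < m) (hx : 0 < x) (hxy : x < y) {b : Word}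
    (hb : b 0 = 1) (h : F x b = m) : F y b < m := by
  have hs : Summable fun k => dig b k / x ^ (k + 1) := by
    by_contra hs
    rw [F, wval_eq, val, tsum_eq_zero_of_not_summable hs] at h
    linarith
  have hsy := (mul_val_le hx hxy.le (dig_nonneg b) hs).1
  have e1 := mul_val hx hs
  have e2 := mul_val (hx.trans hxy) hsy
  rw [dig_eq_one hb] at e1 e2
  have h3 := (mul_val_le hx hxy.le (d := fun k => dig b (k + 1)) (fun k => dig_nonneg b _)
    (summable_val_tail hx hs)).2
  have e3 : val x (fun k => dig b (k + 1)) = m - 1 := by rw [F, wval_eq] at h; linarith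
  rw [F, wval_eq, e2]
  rw [e3] at h3
  have h4 : x * (m - 1) < y * (m - 1) := mul_lt_mul_of_pos_right hxy (by linarith)
  have := lt_of_mul_lt_mul_left (h3.trans_lt h4) (by linarith)
  linarith

theorem existsUnique_isF {u : Word} (hu : TwoOnes u) {m : ℝ} (hm : 1 < m) (hm2 : m ≤ 2) :
    ∃! x, IsF u m x := by
  obtain ⟨hb, k, hk⟩ := hu.supO
  obtain ⟨x, hx, e⟩ := exists_F_eq hm hm2 hb hk
  refine ⟨x, ⟨hx, e⟩, fun y hy => ?_⟩
  rcases lt_trichotomy y x with h | h | h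
  · exact absurd e (F_lt_of_eq hm hy.1 h hb hy.2).ne
  · exact h
  · exact absurd hy.2 (F_lt_of_eq hm hx h hb e).ne

theorem f_eq {u : Word} (hu : TwoOnes u) {m x : ℝ} (hm : 1 < m) (hm2 : m ≤ 2)
    (h : IsF u m x) : f u m = x :=
  (existsUnique_isF hu hm hm2).unique (Classical.epsilon_spec (p := IsF u m) ⟨x, h⟩) h

theorem isF_f {u : Word} (hu : TwoOnes u) {m : ℝ} (hm : 1 < m) (hm2 : m ≤ 2) :
    IsF u m (f u m) :=
  Classical.epsilon_spec (existsUnique_isF hu hm hm2).exists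

theorem isG_g (u : Word) {m : ℝ} (hm : 1 < m) : IsG u m (g u m) :=
  Classical.epsilon_spec (existsUnique_isG u hm).exists

/-- The curves of `f` and `g` cross. -/
theorem exists_cross {a b : Word} (hb : b 0 = 1) {k : ℕ} (hk : b (k + 1) = 1) :
    ∃ x m, 1 < x ∧ 1 < m ∧ m ≤ 2 ∧ F x b = m ∧ H x a = m := by
  obtain ⟨x₁, h1, h1', hF1⟩ := exists_lt_F_of_ones hb {k} (by simpa using hk) (φ := fun x => x)
    continuousAt_id (by simp) 1 one_pos
  obtain ⟨x₂, h2, -, e2⟩ := exists_H_eq (m := 2) (by norm_num) a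
  have hc : ContinuousOn (fun x => F x b - H x a) (Set.Icc x₁ x₂) :=
    ((continuousOn_F b).sub (continuousOn_H a)).mono fun y hy => lt_of_lt_of_le h1 hy.1
  have hF2 : F x₂ b ≤ 2 := by
    have := F_le (x := x₂) (by linarith) b
    have h' : 1 / (x₂ - 1) ≤ 1 := by rw [div_le_one] <;> linarith
    linarith
  obtain ⟨x, hx, e⟩ := intermediate_value_Icc' (by linarith) hc
    (show (0 : ℝ) ∈ Set.Icc _ _ from ⟨by linarith, by linarith [H_le_self h1 a]⟩)
  have hx1 : 1 < x := lt_of_lt_of_le h1 hx.1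
  simp only at e
  refine ⟨x, F x b, hx1, ?_, ?_, rfl, by linarith⟩
  · rw [F_eq hx1 hb]
    have := le_wval_of_ones hx1 (drop 1 b) {k} (by simpa using hk)
    rw [Finset.sum_singleton] at this
    have : 0 < 1 / x ^ (k + 1) := by positivity
    linarith
  · by_contra! hc
    have h3 : 2 < H x a := by linarith
    have h4 := (lt_H_iff (by linarith) hx1 (by norm_num) e2).1 h3
    linarith [hx.2]

theorem existsUnique_isMu {u : Word} (hu : TwoOnes u) : ∃! m, IsMu u m := by
  obtain ⟨hb, k, hk⟩ := hu.supO
  obtain ⟨x, m, hx, hm, hm2, hF, hH⟩ := exists_cross (a := infO u) hb hk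
  have hx0 : 0 < x := by linarith
  refine ⟨m, ⟨⟨hm, hm2⟩, ?_⟩, ?_⟩
  · rw [f_eq hu hm hm2 ⟨hx0, hF⟩, g_eq hm ⟨hx0, hH⟩]
  · rintro n ⟨⟨hn, hn2⟩, e⟩
    have h1 := isG_g u hn
    have h2 := isF_f hu hn hn2
    rw [e] at h2
    have hy := one_lt_of_isG hn h1
    set y := g u n
    have h1' : H y (infO u) = n := h1.2
    have h2' : F y (supO u) = n := h2.2
    rcases lt_trichotomy n m with h | h | h
    · have := (H_lt_iff hx hy hm hH).1 (by rw [h1']; exact h)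
      have := (F_lt_iff hy hx hn hb h2').2 this
      linarith
    · exact h
    · have := (lt_H_iff hx hy hm hH).1 (by rw [h1']; exact h)
      have := (F_lt_iff hx hy hm hb hF).2 this
      linarith

theorem mu_spec {u : Word} (hu : TwoOnes u) :
    ∃ x, 1 < x ∧ 1 < mu u ∧ mu u ≤ 2 ∧ F x (supO u) = mu u ∧ H x (infO u) = mu u := by
  obtain ⟨⟨h1, h2⟩, e⟩ : IsMu u (mu u) := Classical.epsilon_spec (existsUnique_isMu hu).exists
  have hg := isG_g u h1
  have hf := isF_f hu h1 h2
  rw [e] at hf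
  exact ⟨_, one_lt_of_isG h1 hg, h1, h2, hf.2, hg.2⟩

/-! ### Comparison of `f` and `g` -/

/-- Below base `2` the lexicographic order does not control values. In base `2` exactly, the
inequality `a ≼ drop 1 b` gives `H 2 a ≤ F 2 b`, and by monotonicity `F ≤ m ≤ H` can only hold in
larger bases. -/
theorem two_le_of_cross {x m : ℝ} (hx : 1 < x) (hm : 1 < m) {a b : Word} (hb : b 0 = 1)
    (hab : a ≼ drop 1 b) (hF : F x b ≤ m) (hH : m ≤ H x a) : 2 ≤ x := by
  by_contra! hlt
  have h1 := lt_H_of_le hx hlt hm hH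
  have h2 := F_lt_of_le hx hlt hm hb hF
  rw [F_eq (by norm_num) hb] at h2
  have h3 := wval_le_wval (le_refl (2 : ℝ)) hab
  rw [H] at h1
  linarith

/-- For a pair `(a, b)`, the solution of `F x b = m` is at most the solution of `H x a = m`,
in so far as bases `≥ 2` are concerned. This makes sense if `F x b = m` has no solution. -/
def FLeG (m : ℝ) (a b : Word) : Prop := ∀ y, 2 ≤ y → m < F y b → H y a < m

/-- For a pair `(a, b)`, the solution of `H x a = m` is at most the solution of `F x b = m`,
in so far as bases `≥ 2` are concerned. -/
def GLeF (m : ℝ) (a b : Word) : Prop := ∀ y, 2 ≤ y → H y a < m → m < F y b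

theorem fLeG_or_gLeF {m : ℝ} (hm : 1 < m) (a : Word) {b : Word} (hb : b 0 = 1) :
    FLeG m a b ∨ GLeF m a b := by
  by_contra! h
  obtain ⟨h1, h2⟩ := h
  unfold FLeG at h1
  unfold GLeF at h2
  push Not at h1 h2
  obtain ⟨y, hy, hyF, hyH⟩ := h1
  obtain ⟨z, hz, hzH, hzF⟩ := h2
  rcases lt_trichotomy y z with h | h | h
  · have := lt_H_of_le (by linarith) h hm hyH; linarith
  · rw [h] at hyF; linarith
  · have := F_lt_of_le (by linarith) h hm hb hzF; linarith

theorem mu_le_iff {u : Word} (hu : TwoOnes u) (hab : infO u ≼ drop 1 (supO u)) {m : ℝ} :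
    mu u ≤ m ↔ FLeG m (infO u) (supO u) := by
  obtain ⟨x, hx, h1, h2, hF, hH⟩ := mu_spec hu
  have hb := hu.supO.1
  have hx2 := two_le_of_cross hx h1 hb hab hF.le hH.ge
  constructor
  · intro h y hy hyF
    have := (lt_F_iff hx (y := y) (by linarith) h1 hb hF).1 (by linarith)
    have := (H_lt_iff hx (y := y) (by linarith) h1 hH).2 this
    linarith
  · intro h
    by_contra! hc
    have := h x hx2 (by linarith)
    linarith

theorem le_mu_iff {u : Word} (hu : TwoOnes u) (hab : infO u ≼ drop 1 (supO u)) {m : ℝ} :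
    m ≤ mu u ↔ GLeF m (infO u) (supO u) := by
  obtain ⟨x, hx, h1, h2, hF, hH⟩ := mu_spec hu
  have hb := hu.supO.1
  have hx2 := two_le_of_cross hx h1 hb hab hF.le hH.ge
  constructor
  · intro h y hy hyH
    have := (H_lt_iff hx (y := y) (by linarith) h1 hH).1 (by linarith)
    have := (lt_F_iff hx (y := y) (by linarith) h1 hb hF).2 this
    linarith
  · intro h
    by_contra! hc
    have := h x hx2 (by linarith)
    linarith

theorem exists_agree_lt_F {y m : ℝ} (hy : 1 < y) {b : Word} (h : m < F y b) :
    ∃ N, ∀ b', Agree N b b' → m < F y b' :=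
  exists_agree_wval_mem hy (isOpen_lt continuous_const (continuous_const_mul y)) h

theorem exists_agree_F_lt {y m : ℝ} (hy : 1 < y) {b : Word} (h : F y b < m) :
    ∃ N, ∀ b', Agree N b b' → F y b' < m :=
  exists_agree_wval_mem hy (isOpen_lt (continuous_const_mul y) continuous_const) h

theorem exists_agree_lt_H {y m : ℝ} (hy : 1 < y) {a : Word} (h : m < H y a) :
    ∃ N, ∀ a', Agree N a a' → m < H y a' :=
  exists_agree_wval_mem (S := {w | m < (y - 1) * (1 + w)}) hy
    (isOpen_lt continuous_const (by fun_prop)) h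

theorem exists_agree_H_lt {y m : ℝ} (hy : 1 < y) {a : Word} (h : H y a < m) :
    ∃ N, ∀ a', Agree N a a' → H y a' < m :=
  exists_agree_wval_mem (S := {w | (y - 1) * (1 + w) < m}) hy
    (isOpen_lt (by fun_prop) continuous_const) h

theorem exists_gt_lt_F {y m : ℝ} (hy : 1 < y) {b : Word} (h : m < F y b) :
    ∃ z, y < z ∧ m < F z b := by
  have hc := (continuousOn_F b).continuousAt (Ioi_mem_nhds hy)
  obtain ⟨z, h1, h2⟩ := (((hc.eventually (lt_mem_nhds h)).filter_mono
    (nhdsWithin_le_nhds (s := Set.Ioi y))).and self_mem_nhdsWithin).exists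
  exact ⟨z, h2, h1⟩

theorem exists_gt_H_lt {y m : ℝ} (hy : 1 < y) {a : Word} (h : H y a < m) :
    ∃ z, y < z ∧ H z a < m := by
  have hc := (continuousOn_H a).continuousAt (Ioi_mem_nhds hy)
  obtain ⟨z, h1, h2⟩ := (((hc.eventually (gt_mem_nhds h)).filter_mono
    (nhdsWithin_le_nhds (s := Set.Ioi y))).and self_mem_nhdsWithin).exists
  exact ⟨z, h2, h1⟩

/-- The relation `FLeG` is closed under limits of pairs. -/
theorem FLeG.of_approx {m : ℝ} (hm : 1 < m) {a b : Word}
    (h : ∀ N, ∃ a' b', Agree N a a' ∧ Agree N b b' ∧ FLeG m a' b') : FLeG m a b := by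
  intro y hy hF
  by_contra! hH
  have hy1 : 1 < y := by linarith
  obtain ⟨z, hyz, hzF⟩ := exists_gt_lt_F hy1 hF
  have hzH := lt_H_of_le hy1 hyz hm hH
  obtain ⟨N₁, h1⟩ := exists_agree_lt_F (hy1.trans hyz) hzF
  obtain ⟨N₂, h2⟩ := exists_agree_lt_H (hy1.trans hyz) hzH
  obtain ⟨a', b', ha, hb, hab⟩ := h (max N₁ N₂)
  have := hab z (by linarith) (h1 b' (hb.mono (le_max_left _ _)))
  have := h2 a' (ha.mono (le_max_right _ _))
  linarith

/-- The relation `GLeF` is closed under limits of pairs. -/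
theorem GLeF.of_approx {m : ℝ} (hm : 1 < m) {a b : Word} (hb : b 0 = 1)
    (h : ∀ N, ∃ a' b', Agree N a a' ∧ Agree N b b' ∧ GLeF m a' b') : GLeF m a b := by
  intro y hy hH
  by_contra! hF
  have hy1 : 1 < y := by linarith
  obtain ⟨z, hyz, hzH⟩ := exists_gt_H_lt hy1 hH
  have hzF := F_lt_of_le hy1 hyz hm hb hF
  obtain ⟨N₁, h1⟩ := exists_agree_F_lt (hy1.trans hyz) hzF
  obtain ⟨N₂, h2⟩ := exists_agree_H_lt (hy1.trans hyz) hzH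
  obtain ⟨a', b', ha, hb, hab⟩ := h (max N₁ N₂)
  have := hab z (by linarith) (h2 a' (ha.mono (le_max_right _ _)))
  have := h1 b' (hb.mono (le_max_left _ _))
  linarith

theorem F_le_F {y : ℝ} (hy : 2 ≤ y) {b b' : Word} (h : b ≼ b') : F y b ≤ F y b' :=
  mul_le_mul_of_nonneg_left (wval_le_wval hy h) (by linarith)

theorem H_le_H {y : ℝ} (hy : 2 ≤ y) {a a' : Word} (h : a ≼ a') : H y a ≤ H y a' :=
  mul_le_mul_of_nonneg_left (by linarith [wval_le_wval hy h]) (by linarith)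

theorem FLeG.mono {m : ℝ} {a a' b b' : Word} (h : FLeG m a' b') (ha : a ≼ a') (hb : b ≼ b') :
    FLeG m a b :=
  fun y hy hF => (H_le_H hy ha).trans_lt (h y hy (hF.trans_le (F_le_F hy hb)))

theorem GLeF.mono {m : ℝ} {a a' b b' : Word} (h : GLeF m a b) (ha : a ≼ a') (hb : b ≼ b') :
    GLeF m a' b' :=
  fun y hy hH => (h y hy ((H_le_H hy ha).trans_lt hH)).trans_le (F_le_F hy hb)

/-! ### Unique expansions -/

theorem val_sub_val {x D : ℝ} (hx : 1 < x) {d e : ℕ → ℝ} (hd0 : ∀ k, 0 ≤ d k)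
    (hd : ∀ k, d k ≤ D) (he0 : ∀ k, 0 ≤ e k) (he : ∀ k, e k ≤ D) {n : ℕ}
    (h : ∀ i < n, d i = e i) :
    x ^ n * (val x d - val x e) =
      val x (fun k => d (k + n)) - val x fun k => e (k + n) := by
  have hx0 : 0 < x := by linarith
  induction n generalizing d e with
  | zero => simp
  | succ n ih =>
    have h1 := mul_val hx0 (summable_val hx hd0 hd)
    have h2 := mul_val hx0 (summable_val hx he0 he)
    have h3 := ih (d := fun k => d (k + 1)) (e := fun k => e (k + 1)) (fun k => hd0 _)
      (fun k => hd _) (fun k => he0 _) (fun k => he _) fun i hi => h (i + 1) (by omega)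
    have h4 := h 0 (by omega)
    simp only [add_assoc] at h3
    rw [← h3, pow_succ, mul_assoc, mul_sub x, h1, h2, h4]
    ring

/-- The greedy algorithm: every number in `[0, K]` has an expansion with digits in `A` if
the maps `y ↦ x y - d` with `d ∈ A` lead from every point of `[0, K]` back to `[0, K]`. -/
theorem exists_expansion {x K D : ℝ} (hx : 1 < x) {A : Set ℝ} (hA : ∀ d ∈ A, 0 ≤ d ∧ d ≤ D)
    (hK : ∀ y, 0 ≤ y → y ≤ K → ∃ d ∈ A, 0 ≤ x * y - d ∧ x * y - d ≤ K) {y : ℝ} (h0 : 0 ≤ y)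
    (hy : y ≤ K) : ∃ v ∈ seqs A, val x v = y := by
  have hx0 : 0 < x := by linarith
  choose! d hdA hd0 hdK using hK
  set z : ℕ → ℝ := fun n => (fun y => x * y - d y)^[n] y with hz
  have hzs : ∀ n, z (n + 1) = x * z n - d (z n) := fun n => Function.iterate_succ_apply' _ _ _
  have hzK : ∀ n, 0 ≤ z n ∧ z n ≤ K := by
    intro n
    induction n with
    | zero => exact ⟨h0, hy⟩
    | succ n ih => rw [hzs]; exact ⟨hd0 _ ih.1 ih.2, hdK _ ih.1 ih.2⟩
  have hmem : ∀ n, d (z n) ∈ A := fun n => hdA _ (hzK n).1 (hzK n).2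
  refine ⟨fun n => d (z n), hmem, ?_⟩
  have hsum : ∀ n, ∑ i ∈ Finset.range n, d (z i) / x ^ (i + 1) = y - z n / x ^ n := by
    intro n
    induction n with
    | zero => simp [hz]
    | succ n ih =>
      rw [Finset.sum_range_succ, ih, hzs]
      field_simp
      ring
  have hs := (summable_val hx (fun k => (hA _ (hmem k)).1) fun k => (hA _ (hmem k)).2).hasSum
  refine tendsto_nhds_unique hs.tendsto_sum_nat ?_
  have hlim : Tendsto (fun n : ℕ => z n / x ^ n) atTop (𝓝 0) := by
    refine squeeze_zero (fun n => div_nonneg (hzK n).1 (by positivity))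
      (fun n => div_le_div_of_nonneg_right (hzK n).2 (by positivity)) ?_
    exact tendsto_const_nhds.div_atTop (tendsto_pow_atTop_atTop_of_one_lt hx)
  simpa [hsum] using (tendsto_const_nhds (x := y)).sub hlim

theorem exists_dig_eq {u : ℕ → ℝ} (hu : u ∈ seqs {0, 1}) : ∃ w : Word, dig w = u := by
  classical
  refine ⟨fun k => if u k = 0 then 0 else 1, funext fun k => ?_⟩
  rcases hu k with h | h
  · simp [dig, h]
  · have h : u k = 1 := h
    simp [dig, h]

theorem dig_mem_seqs (w : Word) : dig w ∈ seqs {0, 1} := by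
  intro k
  rcases fin2_cases (w k) with h | h
  · exact Or.inl (dig_eq_zero h)
  · exact Or.inr (dig_eq_one h)

/-- The words whose tails satisfy strict forms of the inequalities that define `f` and `g`. For
`2 < β ≤ 1 + m`, these are up to finite prefixes the unique expansions over `{0, 1}`. -/
def admissible (m β : ℝ) : Set Word := {w | ∀ n, m < H β (drop n w) ∧ F β (drop n w) < m}

theorem digit_bounds {m : ℝ} (hm : 1 < m) : ∀ d ∈ ({0, 1, m} : Set ℝ), 0 ≤ d ∧ d ≤ m := by
  rintro d (rfl | rfl | rfl) <;> constructor <;> linarith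

theorem seqs_mono (m : ℝ) : seqs {0, 1} ⊆ seqs {0, 1, m} := by
  intro u hu k
  rcases hu k with h | h
  · exact Or.inl h
  · exact Or.inr (Or.inl h)

/-- The value of a tail `t` after a letter `1` of an admissible word satisfies
`m / (β - 1) < 1 + π_β(t) < m`, hence a first differing digit cannot be compensated. -/
theorem dig_mem_uniqueExp {m β : ℝ} (hm : 1 < m) (hβ : 2 < β) {w : Word}
    (hw : w ∈ admissible m β) : dig w ∈ uniqueExp β {0, 1, m} ∩ seqs {0, 1} := by
  refine ⟨⟨seqs_mono m (dig_mem_seqs w), fun v hv hne heq => ?_⟩, dig_mem_seqs w⟩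
  have hβ1 : 1 < β := by linarith
  have hb := fun k => digit_bounds hm _ (hv k)
  obtain ⟨k₀, hk₀⟩ := Function.ne_iff.1 hne
  classical
  have hex : ∃ k, v k ≠ dig w k := ⟨k₀, hk₀⟩
  set k := Nat.find hex
  have hk : v k ≠ dig w k := Nat.find_spec hex
  have hlt : ∀ i < k, dig w i = v i := fun i hi => (not_not.1 (Nat.find_min hex hi)).symm
  have hwm : ∀ i, dig w i ≤ m := fun i => (dig_le_one w i).trans hm.le
  have h1 := val_sub_val hβ1 (dig_nonneg w) hwm (fun i => (hb i).1) (fun i => (hb i).2) hlt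
  rw [heq, sub_self, mul_zero] at h1
  have h2 := mul_val (d := fun i => v (i + k)) (by linarith)
    (summable_val hβ1 (fun i => (hb _).1) fun i => (hb _).2)
  rw [← sub_eq_zero.1 h1.symm] at h2
  have h3 : β * val β (fun i => dig w (i + k)) = dig w k + wval β (drop (k + 1) w) :=
    wval_drop_succ_eq hβ1 w k
  rw [h3, zero_add] at h2
  have ht0 : 0 ≤ val β fun i => v (i + 1 + k) := val_nonneg (by linarith) fun i => (hb _).1
  have ht1 : (val β fun i => v (i + 1 + k)) ≤ m / (β - 1) :=
    val_le hβ1 (fun i => (hb _).1) fun i => (hb _).2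
  rcases fin2_cases (w k) with h | h
  · rw [dig_eq_zero h] at h2 hk
    have h4 := wval_le hβ1 (drop (k + 1) w)
    have h5 : 1 / (β - 1) < 1 := by rw [div_lt_one] <;> linarith
    rcases hv k with h6 | h6 | h6
    · exact hk h6
    · rw [h6] at h2; linarith
    · have h6 : v k = m := h6
      rw [h6] at h2; linarith
  · rw [dig_eq_one h] at h2 hk
    have h4 := (hw (k + 1)).1
    have h5 := (hw k).2
    rw [F_eq hβ1 (by simpa using h), drop_drop, add_comm 1 k] at h5
    rw [H] at h4
    rcases hv k with h6 | h6 | h6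
    · rw [h6] at h2
      rw [le_div_iff₀ (by linarith), ← zero_add (val β _), ← h2] at ht1
      linarith
    · exact hk h6
    · have h6 : v k = m := h6
      rw [h6] at h2; linarith

/-- In a unique expansion `u` over `{0, 1, m}`, no digit can be changed such that the remaining
value is in the range of the expansions. -/
theorem not_replaceable {m β : ℝ} (hm : 1 < m) (hm2 : m ≤ 2) (hβ1 : 1 < β) (hβ : β ≤ 1 + m)
    {u : ℕ → ℝ} (hu : u ∈ uniqueExp β {0, 1, m}) (k : ℕ) {d : ℝ} (hd : d ∈ ({0, 1, m} : Set ℝ))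
    (hne : d ≠ u k) (h0 : 0 ≤ u k + val β (fun i => u (i + (k + 1))) - d) :
    m / (β - 1) < u k + val β (fun i => u (i + (k + 1))) - d := by
  by_contra! hle
  have hβ0 : 0 < β - 1 := by linarith
  have hK1 : 1 ≤ m / (β - 1) := by rw [le_div_iff₀ hβ0]; linarith
  have hK : β * (m / (β - 1)) = m / (β - 1) + m := by field_simp; ring
  have hgreedy : ∀ y, 0 ≤ y → y ≤ m / (β - 1) →
      ∃ d ∈ ({0, 1, m} : Set ℝ), 0 ≤ β * y - d ∧ β * y - d ≤ m / (β - 1) := by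
    intro y hy0 hy
    have h1 : β * y ≤ β * (m / (β - 1)) := mul_le_mul_of_nonneg_left hy (by linarith)
    have h2 : 0 ≤ β * y := by positivity
    by_cases hym : m ≤ β * y
    · exact ⟨m, by simp, by linarith, by linarith⟩
    by_cases hy1 : 1 ≤ β * y
    · exact ⟨1, by simp, by linarith, by linarith⟩
    · exact ⟨0, by simp, by linarith, by linarith⟩
  obtain ⟨t, ht, hval⟩ := exists_expansion hβ1 (digit_bounds hm) hgreedy h0 hle
  have hub := fun i => digit_bounds hm _ (hu.1 i)
  have htb := fun i => digit_bounds hm _ (ht i)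
  let v : ℕ → ℝ := fun i => if i < k then u i else if i = k then d else t (i - (k + 1))
  have hv : v ∈ seqs {0, 1, m} := by
    intro i
    simp only [v]
    split_ifs
    exacts [hu.1 i, hd, ht _]
  have hvb := fun i => digit_bounds hm _ (hv i)
  have hvk : v k = d := by simp [v]
  have hvt : (fun i => v (i + 1 + k)) = t := by
    funext i
    simp only [v]
    rw [if_neg (by omega), if_neg (by omega)]
    congr 1; omega
  refine hu.2 v hv (fun h => hne (by rw [← h, hvk])) ?_
  have h1 := val_sub_val hβ1 (fun i => (hub i).1) (fun i => (hub i).2) (fun i => (hvb i).1)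
    (fun i => (hvb i).2) (n := k) (fun i hi => by simp [v, hi])
  have h2 := mul_val (x := β) (d := fun i => v (i + k)) (by linarith)
    (summable_val hβ1 (fun i => (hvb _).1) fun i => (hvb _).2)
  have h3 := mul_val (x := β) (d := fun i => u (i + k)) (by linarith)
    (summable_val hβ1 (fun i => (hub _).1) fun i => (hub _).2)
  simp only [zero_add] at h2 h3
  rw [hvt, hval, hvk] at h2
  have e : (fun i => u (i + 1 + k)) = fun i => u (i + (k + 1)) := by
    funext i; congr 1; omega
  rw [e] at h3
  have h4 : val β (fun i => u (i + k)) = val β (fun i => v (i + k)) := by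
    have : β ≠ 0 := by linarith
    apply mul_left_cancel₀ this
    linarith
  rw [h4, sub_self] at h1
  have : β ^ k ≠ 0 := by positivity
  exact sub_eq_zero.1 ((mul_eq_zero.1 h1).resolve_left this)

theorem bounds_of_uniqueExp {m β : ℝ} (hm : 1 < m) (hm2 : m ≤ 2) (hβ1 : 1 < β)
    (hβ : β ≤ 1 + m) {w : Word} (hw : dig w ∈ uniqueExp β {0, 1, m}) {k : ℕ} (hk : w k = 1) :
    m < H β (drop (k + 1) w) ∧ 1 + wval β (drop (k + 1) w) < m := by
  have ht : val β (fun i => dig w (i + (k + 1))) = wval β (drop (k + 1) w) := rfl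
  have ht0 := wval_nonneg (x := β) (by linarith) (drop (k + 1) w)
  have ht1 := wval_le hβ1 (drop (k + 1) w)
  have hrep := fun d => not_replaceable hm hm2 hβ1 hβ hw k (d := d)
  rw [dig_eq_one hk, ht] at hrep
  constructor
  · have := hrep 0 (by simp) (by norm_num) (by linarith)
    rw [sub_zero, div_lt_iff₀ (by linarith), mul_comm] at this
    exact this
  · by_contra! hle
    have := hrep m (by simp) (by linarith) (by linarith)
    have h1 : 1 / (β - 1) ≤ m / (β - 1) := div_le_div_of_nonneg_right hm.le (by linarith)
    linarith

theorem eventually_admissible {m β : ℝ} (hm : 1 < m) (hm2 : m ≤ 2) (hβ2 : 2 < β)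
    (hβ : β ≤ 1 + m) {w : Word} (hw : dig w ∈ uniqueExp β {0, 1, m}) {k : ℕ} (hk : w k = 1) :
    drop (k + 1) w ∈ admissible m β := by
  have hβ1 : 1 < β := by linarith
  have hbd := fun {k} => bounds_of_uniqueExp hm hm2 hβ1 hβ hw (k := k)
  intro n
  rw [drop_drop]
  constructor
  · induction n with
    | zero => rw [zero_add]; exact (hbd hk).1
    | succ n ih =>
      rw [add_right_comm]
      rcases fin2_cases (w (n + (k + 1))) with h | h
      · have e := wval_drop_succ_eq hβ1 w (n + (k + 1))
        have h0 := wval_nonneg (x := β) (by linarith) (drop (n + (k + 1)) w)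
        rw [dig_eq_zero h, zero_add] at e
        refine ih.trans_le (mul_le_mul_of_nonneg_left ?_ (by linarith))
        rw [← e]
        nlinarith
      · exact (hbd h).1
  · rw [F, wval_drop_succ_eq hβ1]
    rcases fin2_cases (w (n + (k + 1))) with h | h
    · have h1 := wval_le hβ1 (drop (n + (k + 1) + 1) w)
      have h2 : 1 / (β - 1) < 1 := by rw [div_lt_one] <;> linarith
      rw [dig_eq_zero h]
      linarith
    · rw [dig_eq_one h]; exact (hbd h).2

theorem countable_uniqueExp {m β : ℝ} (hm : 1 < m) (hm2 : m ≤ 2) (hβ1 : 1 < β)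
    (hβ : β ≤ 1 + m) (h : 2 < β → (admissible m β).Countable) :
    (uniqueExp β {0, 1, m} ∩ seqs {0, 1}).Countable := by
  have hzero : ∀ w : Word, (∀ k, w k ≠ 1) → w = const 0 := fun w hw => funext fun k => by
    have := hw k
    rw [const_apply]; omega
  rcases lt_or_ge 2 β with h2 | h2
  · refine (((countable_eventually_mem (h h2)).union
      (Set.countable_singleton (const 0))).image dig).mono ?_
    rintro u ⟨hu, hu'⟩
    obtain ⟨w, rfl⟩ := exists_dig_eq hu'
    refine ⟨w, ?_, rfl⟩
    by_cases hw : ∃ k, w k = 1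
    · obtain ⟨k, hk⟩ := hw
      exact Or.inl ⟨k + 1, eventually_admissible hm hm2 h2 hβ hu hk⟩
    · push Not at hw
      exact Or.inr (hzero w hw)
  · refine (Set.countable_singleton (dig (const 0))).mono ?_
    rintro u ⟨hu, hu'⟩
    obtain ⟨w, rfl⟩ := exists_dig_eq hu'
    refine congrArg dig (hzero w fun k hk => ?_)
    obtain ⟨h3, h4⟩ := bounds_of_uniqueExp hm hm2 hβ1 hβ hu hk
    rw [H] at h3
    nlinarith

/-- Below the curves of a pair that is approximated by substitutions, there are only countably
many admissible words. -/
theorem countable_admissible {m β : ℝ} (hβ : 2 < β) {a b : Word} (hab : Approx a b)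
    (ha : H β a < m) (hb : m < F β b) : (admissible m β).Countable := by
  have hβ1 : 1 < β := by linarith
  obtain ⟨N₁, h1⟩ := exists_agree_H_lt hβ1 ha
  obtain ⟨N₂, h2⟩ := exists_agree_lt_F hβ1 hb
  obtain ⟨σ, hσ⟩ := hab (max N₁ N₂)
  obtain ⟨h3, h4⟩ := hσ (const 0) (cons 1 (const 0)) rfl rfl
  have h5 := h1 _ (h3.mono (le_max_left _ _))
  have h6 := h2 _ (h4.mono (le_max_right _ _))
  refine (countable_inside σ).mono fun w hw => ?_
  intro n
  obtain ⟨h7, h8⟩ := hw n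
  constructor
  · have h9 := h5.trans h7
    rw [H, H] at h9
    have := lt_of_mul_lt_mul_left h9 (by linarith)
    exact lt_of_wval_lt hβ.le (by linarith)
  · have h9 := h8.trans h6
    rw [F, F] at h9
    exact lt_of_wval_lt hβ.le (lt_of_mul_lt_mul_left h9 (by linarith))

/-! ### Hausdorff dimension -/

theorem listOnList_append (σ : List Gen) (l l' : List (Fin 2)) :
    listOnList σ (l ++ l') = listOnList σ l ++ listOnList σ l' := by
  induction σ with
  | nil => rfl
  | cons s σ ih =>
    have e : ∀ l, listOnList (s :: σ) l = s.onList (listOnList σ l) := fun _ => rfl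
    rw [e, e, e, ih, onList_append]

theorem length_le_listOnList (σ : List Gen) (l : List (Fin 2)) :
    l.length ≤ (listOnList σ l).length := by
  induction σ with
  | nil => exact le_rfl
  | cons s σ ih => exact ih.trans (length_le_onList s _)

/-- The words `σ M(w)` are the concatenations of the blocks `σ(01)` and `σ(10)`, which have the
same length. -/
theorem exists_block_length (σ : List Gen) : ∃ l, 0 < l ∧ ∀ k (u v : Word),
    Agree (k * l) (listOnWord σ (Gen.M.onWord u)) (listOnWord σ (Gen.M.onWord v)) →
      Agree k u v := by
  set B : Fin 2 → List (Fin 2) := fun a => listOnList σ (Gen.M.letter a) with hB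
  have hlen : ∀ a, (B a).length = (B 0).length := by
    have h01 : Gen.M.letter 0 = [0] ++ [1] := rfl
    have h10 : Gen.M.letter 1 = [1] ++ [0] := rfl
    intro a
    rcases fin2_cases a with rfl | rfl
    · rfl
    · simp only [hB]
      rw [h01, h10, listOnList_append, listOnList_append, List.length_append,
        List.length_append, add_comm]
  have hX : ∀ a u, listOnWord σ (Gen.M.onWord (cons a u)) =
      app (B a) (listOnWord σ (Gen.M.onWord u)) := fun a u => by
    rw [onWord_cons, listOnWord_app]
  have hne : ∀ a b, B a = B b → a = b := by
    have h01 : B 0 ≠ B 1 := by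
      intro h
      have : listOnWord σ (Gen.M.onWord (cons 0 (const 0))) ≺
          listOnWord σ (Gen.M.onWord (cons 1 (const 0))) :=
        listOnWord_lt σ (onWord_lt .M (lt_of_head rfl rfl))
      rw [hX, hX, h] at this
      exact lt_irrefl _ this
    intro a b hab
    rcases fin2_cases a with rfl | rfl <;> rcases fin2_cases b with rfl | rfl
    exacts [rfl, absurd hab h01, absurd hab.symm h01, rfl]
  refine ⟨(B 0).length, ?_, fun k => ?_⟩
  · exact lt_of_lt_of_le (by simp [Gen.letter]) (length_le_listOnList σ (Gen.M.letter 0))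
  induction k with
  | zero => exact fun _ _ _ => agree_zero _ _
  | succ k ih =>
    intro u v h
    rw [← cons_drop_one u, ← cons_drop_one v] at h ⊢
    rw [hX, hX, Nat.succ_mul] at h
    have hB' : B (u 0) = B (v 0) := by
      refine List.ext_getElem ((hlen _).trans (hlen _).symm) fun i h1 h2 => ?_
      have := h i (by rw [hlen] at h1; omega)
      rwa [app_apply_lt _ _ h1, app_apply_lt _ _ h2, List.getD_eq_getElem _ _ h1,
        List.getD_eq_getElem _ _ h2] at this
    rw [hne _ _ hB']
    refine agree_cons_iff.2 (ih _ _ fun i hi => ?_)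
    have := h ((B 0).length + i) (by omega)
    rw [← hlen (u 0), app_apply_add, hB', app_apply_add] at this
    exact this

/-- A map `Φ` from the infinite words to the reals that separates words at a geometric rate has
a range of positive dimension, since `Φ(w) ↦ π₂(w)` is Hölder continuous and maps onto the unit
interval. -/
theorem dimH_range_pos {Φ : Word → ℝ} {c B : ℝ} (hc : 0 < c) (hB : 1 < B)
    (hΦ : ∀ k u v, ¬Agree (k + 1) u v → c / B ^ (k + 1) ≤ |Φ u - Φ v|) :
    0 < dimH (Set.range Φ) := by
  have hB0 : 0 < B := by linarith
  have hlog : 0 < Real.log B := Real.log_pos hB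
  set r : ℝ := Real.log 2 / Real.log B with hr
  have hr0 : 0 < r := div_pos (Real.log_pos (by norm_num)) hlog
  have hBr : B ^ r = 2 := by
    rw [Real.rpow_def_of_pos hB0, hr, mul_div_cancel₀ _ hlog.ne', Real.exp_log (by norm_num)]
  have hinj : Function.Injective Φ := by
    intro u v huv
    refine eq_of_forall_agree fun N => ?_
    by_contra hN
    have := hΦ N u v fun h => hN (h.mono (Nat.le_succ N))
    rw [huv, sub_self, abs_zero] at this
    have : 0 < c / B ^ (N + 1) := by positivity
    linarith
  set G : ℝ → ℝ := fun y => wval 2 (Function.invFun Φ y) with hG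
  have hGΦ : ∀ u, G (Φ u) = wval 2 u := fun u => by
    simp only [hG]; rw [Function.leftInverse_invFun hinj u]
  have hreal : ∀ u v, |wval 2 u - wval 2 v| ≤ 2 / c ^ r * |Φ u - Φ v| ^ r := by
    intro u v
    by_cases huv : u = v
    · subst huv
      rw [sub_self, abs_zero]; positivity
    classical
    have hex : ∃ k, u k ≠ v k := Function.ne_iff.1 huv
    set k := Nat.find hex
    have h1 : Agree k u v := fun i hi => not_not.1 (Nat.find_min hex hi)
    have h2 := hΦ k u v fun h => Nat.find_spec hex (h k (Nat.lt_succ_self k))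
    have h3 := abs_wval_sub_le (x := 2) (by norm_num) h1
    have h4 := Real.rpow_le_rpow (by positivity) h2 hr0.le
    rw [Real.div_rpow hc.le (by positivity), ← Real.rpow_pow_comm hB0.le, hBr] at h4
    have h5 : 0 < c ^ r := by positivity
    calc |wval 2 u - wval 2 v| ≤ 1 / (2 - 1) / 2 ^ k := h3
      _ = 2 / c ^ r * (c ^ r / 2 ^ (k + 1)) := by field_simp; ring
      _ ≤ 2 / c ^ r * |Φ u - Φ v| ^ r := by gcongr
  have hC : 0 ≤ 2 / c ^ r := by positivity
  have hhol : HolderOnWith (2 / c ^ r).toNNReal r.toNNReal G (Set.range Φ) := by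
    rintro _ ⟨u, rfl⟩ _ ⟨v, rfl⟩
    rw [hGΦ, hGΦ, edist_dist, edist_dist, Real.dist_eq, Real.dist_eq, Real.coe_toNNReal _ hr0.le,
      ENNReal.ofReal_rpow_of_nonneg (abs_nonneg _) hr0.le, ← ENNReal.ofReal,
      ← ENNReal.ofReal_mul hC]
    exact ENNReal.ofReal_le_ofReal (hreal u v)
  have hdim := hhol.dimH_image_le (Real.toNNReal_pos.2 hr0)
  have hsub : Set.Icc (0 : ℝ) 1 ⊆ G '' Set.range Φ := by
    rintro y ⟨h0, h1⟩
    obtain ⟨v, hv, e⟩ := exists_expansion (x := 2) (K := 1) (D := 1) (A := {0, 1}) (by norm_num)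
      (by rintro d (rfl | rfl) <;> norm_num) (fun y hy0 hy1 => by
        by_cases hy : 1 ≤ 2 * y
        · exact ⟨1, by simp, by linarith, by linarith⟩
        · exact ⟨0, by simp, by linarith, by linarith⟩) h0 h1
    obtain ⟨w, rfl⟩ := exists_dig_eq hv
    exact ⟨Φ w, ⟨w, rfl⟩, by rw [hGΦ]; exact e⟩
  have hone : dimH (Set.Icc (0 : ℝ) 1) = 1 := by
    rw [Real.dimH_of_nonempty_interior (by rw [interior_Icc]; exact ⟨1 / 2, by norm_num⟩)]
    simp
  rw [pos_iff_ne_zero]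
  intro h0
  rw [h0, ENNReal.zero_div] at hdim
  have := (dimH_mono hsub).trans hdim
  rw [hone] at this
  exact absurd this (by simp)

theorem dimH_substitution_pos {β : ℝ} (hβ : 2 < β) (σ : List Gen) :
    0 < dimH (Set.range fun w => wval β (listOnWord σ (Gen.M.onWord w))) := by
  have hβ1 : 1 < β := by linarith
  obtain ⟨l, hl, hagree⟩ := exists_block_length σ
  refine dimH_range_pos (c := (β - 2) / (β - 1)) (B := β ^ l)
    (div_pos (by linarith) (by linarith)) (one_lt_pow₀ hβ1 hl.ne') fun k u v huv => ?_
  have hX : ¬Agree ((k + 1) * l) (listOnWord σ (Gen.M.onWord u))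
      (listOnWord σ (Gen.M.onWord v)) := fun h => huv (hagree _ _ _ h)
  unfold Agree at hX
  push Not at hX
  classical
  have hp := Nat.find_spec hX
  have hmin : Agree (Nat.find hX) (listOnWord σ (Gen.M.onWord u))
      (listOnWord σ (Gen.M.onWord v)) := fun i hi => by
    by_contra hc
    exact Nat.find_min hX hi ⟨by omega, hc⟩
  refine le_trans ?_ (le_abs_wval_sub hβ hmin hp.2)
  rw [← pow_mul, mul_comm l]
  refine div_le_div_of_nonneg_left (div_nonneg (by linarith) (by linarith)) (by positivity) ?_
  exact pow_le_pow_right₀ hβ1.le hp.1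

/-- Above the curves of a pair that is approximated by substitutions, all concatenations of two
blocks of the same length are admissible. -/
theorem dimH_pos_of_approx {m c β : ℝ} (hm : 1 < m) (hc : 2 ≤ c) (hcβ : c < β) {a b : Word}
    (hb0 : b 0 = 1) (hab : Approx a b) (hF : F c b ≤ m) (hH : m ≤ H c a) :
    0 < dimH (val β '' (uniqueExp β {0, 1, m} ∩ seqs {0, 1})) := by
  have hβ1 : 1 < β := by linarith
  obtain ⟨N₁, h1⟩ := exists_agree_lt_H hβ1 (lt_H_of_le (by linarith) hcβ hm hH)
  obtain ⟨N₂, h2⟩ := exists_agree_F_lt hβ1 (F_lt_of_le (by linarith) hcβ hm hb0 hF)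
  obtain ⟨σ, hσ⟩ := hab (max N₁ N₂)
  obtain ⟨h3, h4⟩ := hσ (const 0) (const 1) rfl rfl
  have h5 := h1 _ (h3.mono (le_max_left _ _))
  have h6 := h2 _ (h4.mono (le_max_right _ _))
  refine (dimH_substitution_pos (by linarith : 2 < β) σ).trans_le (dimH_mono ?_)
  rintro _ ⟨w, rfl⟩
  refine ⟨dig (listOnWord σ (Gen.M.onWord w)), dig_mem_uniqueExp hm (by linarith) fun n => ?_, rfl⟩
  obtain ⟨h7, h8⟩ := (within_const (Gen.M.onWord w)).listOnWord rfl rfl σ n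
  constructor
  · exact h5.trans_le (H_le_H (by linarith) h7)
  · exact (F_le_F (by linarith) h8).trans_lt h6

theorem critBase_eq {m c : ℝ} (hm : 1 < m) (hm2 : m ≤ 2) (hc : 2 ≤ c) (hcm : c ≤ 1 + m)
    (hup : ∀ β, c < β → 0 < dimH (val β '' (uniqueExp β {0, 1, m} ∩ seqs {0, 1})))
    (hlow : ∀ β, 2 < β → β < c → (admissible m β).Countable) : critBase m = c := by
  have hmem : ∀ β, c < β →
      1 < β ∧ ¬(uniqueExp β {0, 1, m} ∩ seqs {0, 1}).Countable := fun β hβ =>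
    ⟨by linarith, fun hcount => (hup β hβ).ne' (dimH_countable (hcount.image _))⟩
  refine csInf_eq_of_forall_ge_of_forall_gt_exists_lt ⟨c + 1, hmem _ (by linarith)⟩ ?_ ?_
  · rintro β ⟨hβ1, hβ⟩
    by_contra! hlt
    exact hβ (countable_uniqueExp hm hm2 hβ1 (by linarith) fun h2 => hlow β h2 hlt)
  · intro x hx
    exact ⟨(c + x) / 2, hmem _ (by linarith), by linarith⟩

/-! ### The critical base in the four cases -/

theorem loList_le {σ : List Gen} {u v : Word} (h : u ≼ v) : loList σ u ≼ loList σ v := by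
  induction σ with
  | nil => exact h
  | cons s σ ih => exact not_lt.1 fun h' => absurd ih (not_le.2 ((lo_lt_iff s).1 h'))

theorem le_one_add_of_H_eq {m c : ℝ} (hm : 1 < m) (hc : 1 < c) {a : Word} (h : H c a = m) :
    c ≤ 1 + m := by
  by_contra! hlt
  have := (H_lt_iff hc (by linarith) hm h).2 hlt
  linarith [H_one_add_ge hm a]

theorem two_le_of_fLeG {m c : ℝ} (hm : 1 < m) (hc : 1 < c) {a b : Word} (hb : b 0 = 1)
    (hab : a ≼ drop 1 b) (hle : FLeG m a b) (h : H c a = m) : 2 ≤ c := by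
  by_contra! hlt
  have h1 := (lt_H_iff hc (by norm_num) hm h).2 hlt
  have h2 := wval_le_wval (le_refl (2 : ℝ)) hab
  have h3 := F_eq (x := 2) (by norm_num) hb
  refine absurd (hle 2 le_rfl ?_) h1.not_gt
  rw [H] at h1
  linarith

theorem F_le_of_fLeG {m c : ℝ} (hc : 2 ≤ c) {a b : Word} (hle : FLeG m a b) (h : H c a = m) :
    F c b ≤ m := by
  by_contra! hlt
  have := hle c hc hlt
  linarith

/-- On a plateau with constant first component, the critical base is given by `g`. -/
theorem critBase_eq_of_common_lo {m c : ℝ} (hm : 1 < m) (hm2 : m ≤ 2) (hc : 1 < c)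
    {a b b' : Word} (hb : b 0 = 1) (hab : a ≼ drop 1 b) (h1 : Approx a b) (h2 : Approx a b')
    (hle : FLeG m a b) (hge : GLeF m a b') (h : H c a = m) :
    critBase m = c ∧
      ∀ β, c < β → 0 < dimH (val β '' (uniqueExp β {0, 1, m} ∩ seqs {0, 1})) := by
  have hc2 := two_le_of_fLeG hm hc hb hab hle h
  have hup : ∀ β, c < β → 0 < dimH (val β '' (uniqueExp β {0, 1, m} ∩ seqs {0, 1})) :=
    fun β hβ => dimH_pos_of_approx hm hc2 hβ hb h1 (F_le_of_fLeG hc2 hle h) h.ge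
  refine ⟨critBase_eq hm hm2 hc2 (le_one_add_of_H_eq hm hc h) hup fun β hβ hβc => ?_, hup⟩
  have h3 := (H_lt_iff hc (by linarith) hm h).2 hβc
  exact countable_admissible hβ h2 h3 (hge β hβ.le h3)

/-- On a plateau with constant second component, the critical base is given by `f`. -/
theorem critBase_eq_of_common_hi {m c : ℝ} (hm : 1 < m) (hm2 : m ≤ 2) (hc : 0 < c)
    {a a' b : Word} (hb : b 0 = 1) (hab : a' ≼ drop 1 b) (h1 : Approx a b) (h2 : Approx a' b)
    (hle : FLeG m a b) (hge : GLeF m a' b) (h : F c b = m) :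
    critBase m = c ∧
      ∀ β, c < β → 0 < dimH (val β '' (uniqueExp β {0, 1, m} ∩ seqs {0, 1})) := by
  have hc2 : 2 ≤ c := by
    by_contra! hlt
    have h3 := F_lt_of_eq hm hc hlt hb h
    have h4 := wval_le_wval (le_refl (2 : ℝ)) hab
    have h5 := F_eq (x := 2) (by norm_num) hb
    have h6 := hge 2 le_rfl (by rw [H]; linarith)
    linarith
  have hH : m ≤ H c a' := by
    by_contra! hlt
    have := hge c hc2 hlt
    linarith
  have hup : ∀ β, c < β → 0 < dimH (val β '' (uniqueExp β {0, 1, m} ∩ seqs {0, 1})) :=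
    fun β hβ => dimH_pos_of_approx hm hc2 hβ hb h2 h.le hH
  have hcm : c ≤ 1 + m := by
    by_contra! hlt
    have h3 := (lt_F_iff (by linarith) (by linarith : 1 < 1 + m) hm hb h).2 hlt
    have := hle (1 + m) (by linarith) h3
    linarith [H_one_add_ge hm a]
  refine ⟨critBase_eq hm hm2 hc2 hcm hup fun β hβ hβc => ?_, hup⟩
  have h3 := (lt_F_iff (by linarith) (by linarith : 1 < β) hm hb h).2 hβc
  exact countable_admissible hβ h1 (hle β hβ.le h3) h3

/-- No tail of an admissible word is smaller than `0111⋯` if `H β (0111⋯) < m`, thus such a word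
has no letter `0`. -/
theorem countable_admissible_of_zero_ones {m β : ℝ} (hβ : 2 < β)
    (h : H β (cons 0 (const 1)) < m) : (admissible m β).Countable := by
  refine (Set.countable_singleton (const 1)).mono fun w hw => ?_
  refine Set.mem_singleton_iff.2 (funext fun k => ?_)
  by_contra hk
  have h0 : w k = 0 := by simp only [const_apply] at hk; omega
  have h1 := h.trans (hw k).1
  have h2 : drop k w ≼ cons 0 (const 1) := by
    rw [← cons_drop w k, h0, cons_le_cons]
    exact le_const_one _
  linarith [H_le_H hβ.le h2]

theorem critBase_eq_of_zero_ones {m c : ℝ} (hm : 1 < m) (hm2 : m ≤ 2) (hc : 1 < c)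
    (hle : FLeG m (cons 0 (const 1)) (const 1)) (h : H c (cons 0 (const 1)) = m) :
    critBase m = c ∧
      ∀ β, c < β → 0 < dimH (val β '' (uniqueExp β {0, 1, m} ∩ seqs {0, 1})) := by
  have hc2 := two_le_of_fLeG hm hc rfl (le_const_one _) hle h
  have hup : ∀ β, c < β → 0 < dimH (val β '' (uniqueExp β {0, 1, m} ∩ seqs {0, 1})) :=
    fun β hβ => dimH_pos_of_approx hm hc2 hβ rfl (approx_upper []) (F_le_of_fLeG hc2 hle h) h.ge
  refine ⟨critBase_eq hm hm2 hc2 (le_one_add_of_H_eq hm hc h) hup fun β hβ hβc => ?_, hup⟩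
  exact countable_admissible_of_zero_ones hβ ((H_lt_iff hc (by linarith) hm h).2 hβc)

/-! ### The two plateaus of a product of substitutions -/

/-- The pair of `τ(L(101⋯))` and of `τ(M(10⋯))`: left end of the left plateau. -/
theorem extremal_left_start (τ : List Gen) :
    Extremal (loList (τ ++ [Gen.L]) (cons 0 (const 1))) (hiList (τ ++ [Gen.L]) (const 1))
      (listOnWord (τ ++ [Gen.M]) (evConst [1] 0)) := by
  rw [loList_append, hiList_append, listOnWord_append]
  exact extremal_M_one_zeros.listOnWord τ

theorem extremal_left_end (τ : List Gen) :
    Extremal (loList (τ ++ [Gen.M]) (const 0)) (hiList (τ ++ [Gen.M]) (cons 1 (const 0)))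
      (listOnWord (τ ++ [Gen.M]) (evConst [0, 1] 0)) :=
  extremal_zero_one.listOnWord _

theorem extremal_right_start (τ : List Gen) :
    Extremal (loList (τ ++ [Gen.M]) (cons 0 (const 1))) (hiList (τ ++ [Gen.M]) (const 1))
      (listOnWord (τ ++ [Gen.M]) (evConst [1, 0] 1)) :=
  extremal_one_zero.listOnWord _

theorem extremal_right_end (τ : List Gen) :
    Extremal (loList (τ ++ [Gen.R]) (const 0)) (hiList (τ ++ [Gen.R]) (cons 1 (const 0)))
      (listOnWord (τ ++ [Gen.M]) (evConst [0] 1)) := by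
  have e : listOnWord (τ ++ [Gen.M]) (evConst [0] 1) = listOnWord (τ ++ [Gen.R]) (evConst [0, 1] 0) := by
    rw [listOnWord_append, listOnWord_append, listOnWord_cons, listOnWord_nil, M_zero_ones]
    rfl
  rw [e]
  exact extremal_zero_one.listOnWord _

theorem twoOnes_append_M (τ : List Gen) (u : Word) : TwoOnes (listOnWord (τ ++ [Gen.M]) u) := by
  rw [listOnWord_append]; exact twoOnes_M τ u

theorem Extremal.mu_le_iff {a b u : Word} (h : Extremal a b u) (hu : TwoOnes u) {m : ℝ} :
    mu u ≤ m ↔ FLeG m a b := by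
  rw [← h.infO_eq, ← h.supO_eq]
  exact TMS.mu_le_iff hu (by rw [h.infO_eq, h.supO_eq]; exact h.lo_le_tail)

theorem Extremal.le_mu_iff {a b u : Word} (h : Extremal a b u) (hu : TwoOnes u) {m : ℝ} :
    m ≤ mu u ↔ GLeF m a b := by
  rw [← h.infO_eq, ← h.supO_eq]
  exact TMS.le_mu_iff hu (by rw [h.infO_eq, h.supO_eq]; exact h.lo_le_tail)

theorem loList_left (τ : List Gen) :
    loList (τ ++ [Gen.L]) (cons 0 (const 1)) = loList (τ ++ [Gen.M]) (const 0) := by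
  rw [loList_append, loList_append, loList_cons, loList_cons, loList_nil, loList_nil,
    lo_L_eq_lo_M]

theorem hiList_left_le (τ : List Gen) :
    hiList (τ ++ [Gen.L]) (const 1) ≼ hiList (τ ++ [Gen.M]) (cons 1 (const 0)) := by
  rw [hiList_append, hiList_append]
  exact hiList_le hi_L_le_hi_M

theorem hiList_right (τ : List Gen) :
    hiList (τ ++ [Gen.M]) (const 1) = hiList (τ ++ [Gen.R]) (cons 1 (const 0)) := by
  rw [hiList_append, hiList_append, hiList_cons, hiList_cons, hiList_nil, hiList_nil,
    hi_M_eq_hi_R]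

theorem loList_right_le (τ : List Gen) :
    loList (τ ++ [Gen.M]) (cons 0 (const 1)) ≼ loList (τ ++ [Gen.R]) (const 0) := by
  rw [loList_append, loList_append]
  refine loList_le ?_
  rw [← cons_const 0, loList_cons, loList_cons, loList_nil, loList_nil, lo, lo, onWord_R_zero,
    cons_le_cons]
  exact (lt_of_head (by simp) rfl).le

theorem critBase_left {m : ℝ} (hm : 1 < m) (hm2 : m ≤ 2) (τ : List Gen)
    (h : m ∈ Set.Icc (mu (listOnWord (τ ++ [Gen.M]) (evConst [1] 0)))
      (mu (listOnWord (τ ++ [Gen.M]) (evConst [0, 1] 0)))) :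
    critBase m = g (listOnWord (τ ++ [Gen.M]) (evConst [1] 0)) m ∧
      ∀ β, critBase m < β → 0 < dimH (val β '' (uniqueExp β {0, 1, m} ∩ seqs {0, 1})) := by
  have h1 := extremal_left_start τ
  have h2 := extremal_left_end τ
  have hle := (h1.mu_le_iff (twoOnes_append_M _ _)).1 h.1
  have hge := (h2.le_mu_iff (twoOnes_append_M _ _)).1 h.2
  have hg := isG_g (listOnWord (τ ++ [Gen.M]) (evConst [1] 0)) hm
  have hH := hg.2
  rw [h1.infO_eq] at hH
  rw [← loList_left] at hge
  have hap := approx_lower (τ ++ [Gen.M])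
  rw [← loList_left] at hap
  obtain ⟨e, hdim⟩ := critBase_eq_of_common_lo hm hm2 (one_lt_of_isG hm hg) h1.hi_head
    h1.lo_le_tail (approx_upper _) hap hle hge hH
  exact ⟨e, by rw [e]; exact hdim⟩

theorem critBase_right {m : ℝ} (hm : 1 < m) (hm2 : m ≤ 2) (τ : List Gen)
    (h : m ∈ Set.Icc (mu (listOnWord (τ ++ [Gen.M]) (evConst [1, 0] 1)))
      (mu (listOnWord (τ ++ [Gen.M]) (evConst [0] 1)))) :
    critBase m = f (listOnWord (τ ++ [Gen.M]) (evConst [0] 1)) m ∧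
      ∀ β, critBase m < β → 0 < dimH (val β '' (uniqueExp β {0, 1, m} ∩ seqs {0, 1})) := by
  have h1 := extremal_right_start τ
  have h2 := extremal_right_end τ
  have hle := (h1.mu_le_iff (twoOnes_append_M _ _)).1 h.1
  have hge := (h2.le_mu_iff (twoOnes_append_M _ _)).1 h.2
  have hf := isF_f (twoOnes_append_M τ (evConst [0] 1)) hm hm2
  have hF := hf.2
  rw [h2.supO_eq] at hF
  rw [hiList_right] at hle
  have hap := approx_upper (τ ++ [Gen.M])
  rw [hiList_right] at hap
  obtain ⟨e, hdim⟩ := critBase_eq_of_common_hi hm hm2 hf.1 h2.hi_head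
    h2.lo_le_tail hap (approx_lower _) hle hge hF
  exact ⟨e, by rw [e]; exact hdim⟩

theorem infO_zero_ones : infO (evConst [0] 1) = cons 0 (const 1) := by
  have h := infO_le (evConst [0] 1) 0
  rw [drop_zero, evConst_eq_app] at h
  have h' := le_infO (u := evConst [0] 1) fun n => (within_zero_ones n).1
  rw [evConst_eq_app] at h' ⊢
  exact toLex_inj.1 (le_antisymm h h')

theorem supO_zero_ones : supO (evConst [0] 1) = const 1 := by
  have h := le_supO (evConst [0] 1) 1
  rw [evConst_eq_app] at h ⊢
  exact toLex_inj.1 (le_antisymm (le_const_one _) h)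

theorem mu_zero_ones_le_iff {m : ℝ} :
    mu (evConst [0] 1) ≤ m ↔ FLeG m (cons 0 (const 1)) (const 1) := by
  rw [← infO_zero_ones, ← supO_zero_ones]
  exact mu_le_iff ⟨1, 2, by decide, rfl, rfl⟩ (by rw [supO_zero_ones]; exact le_const_one _)

theorem critBase_zero_ones {m : ℝ} (hm : 1 < m) (hm2 : m ≤ 2) (h : mu (evConst [0] 1) ≤ m) :
    critBase m = g (evConst [0] 1) m ∧
      ∀ β, critBase m < β → 0 < dimH (val β '' (uniqueExp β {0, 1, m} ∩ seqs {0, 1})) := by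
  have hg := isG_g (evConst [0] 1) hm
  have hH := hg.2
  rw [infO_zero_ones] at hH
  obtain ⟨e, hdim⟩ := critBase_eq_of_zero_ones hm hm2 (one_lt_of_isG hm hg)
    (mu_zero_ones_le_iff.1 h) hH
  exact ⟨e, by rw [e]; exact hdim⟩

theorem critBase_tms {u : Word} (hu : u ∈ tmsWords) :
    critBase (mu u) = f u (mu u) ∧ ∀ β, critBase (mu u) < β →
      0 < dimH (val β '' (uniqueExp β {0, 1, mu u} ∩ seqs {0, 1})) := by
  obtain ⟨s, hs, hlim⟩ := hu
  have htwo := hs.twoOnes hlim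
  have hab := hs.infO_le_tail hlim
  obtain ⟨x, hx, h1, h2, hF, hH⟩ := mu_spec htwo
  obtain ⟨e, hdim⟩ := critBase_eq_of_common_lo h1 h2 hx (hs.supO_head hlim) hab (hs.approx hlim)
    (hs.approx hlim) ((mu_le_iff htwo hab).1 le_rfl) ((le_mu_iff htwo hab).1 le_rfl) hH
  rw [f_eq htwo h1 h2 ⟨by linarith, hF⟩]
  exact ⟨e, by rw [e]; exact hdim⟩

/-! ### The four cases cover the interval -/

/-- `m` is between the numbers `μ` of `σ(010⋯)` and of `σ(101⋯)`. -/
def IsNode (m : ℝ) (σ : List Gen) : Prop :=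
  FLeG m (loList σ (const 0)) (hiList σ (cons 1 (const 0))) ∧
    GLeF m (loList σ (cons 0 (const 1))) (hiList σ (const 1))

theorem F_one_zero {y : ℝ} (hy : 1 < y) : F y (cons 1 (const 0)) = 1 := by
  rw [F_eq hy rfl, drop_one_cons, add_eq_left, wval_eq, val]
  have : ∀ k, dig (const 0) k = 0 := fun k => dig_eq_zero rfl
  simp [this]

theorem loList_append_L (σ : List Gen) : loList (σ ++ [Gen.L]) (const 0) = loList σ (const 0) := by
  rw [loList_append, loList_cons, loList_nil, lo_L_const_zero]

theorem hiList_append_L (σ : List Gen) :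
    hiList (σ ++ [Gen.L]) (cons 1 (const 0)) = hiList σ (cons 1 (const 0)) := by
  rw [hiList_append, hiList_cons, hiList_nil, hi_L_one_zero]

theorem loList_append_R (σ : List Gen) :
    loList (σ ++ [Gen.R]) (cons 0 (const 1)) = loList σ (cons 0 (const 1)) := by
  rw [loList_append, loList_cons, loList_nil, lo_R_zero_one]

theorem hiList_append_R (σ : List Gen) : hiList (σ ++ [Gen.R]) (const 1) = hiList σ (const 1) := by
  rw [hiList_append, hiList_cons, hiList_nil, hi_R_const_one]

/-- The interval of `σ` is the union of the intervals of `σL`, `σM`, `σR` and of the two plateaus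
that belong to `σM`. -/
theorem IsNode.exists_child {m : ℝ} (hm : 1 < m) {σ : List Gen} (h : IsNode m σ)
    (h1 : ¬(FLeG m (loList (σ ++ [Gen.L]) (cons 0 (const 1))) (hiList (σ ++ [Gen.L]) (const 1)) ∧
      GLeF m (loList (σ ++ [Gen.M]) (const 0)) (hiList (σ ++ [Gen.M]) (cons 1 (const 0)))))
    (h2 : ¬(FLeG m (loList (σ ++ [Gen.M]) (cons 0 (const 1))) (hiList (σ ++ [Gen.M]) (const 1)) ∧
      GLeF m (loList (σ ++ [Gen.R]) (const 0)) (hiList (σ ++ [Gen.R]) (cons 1 (const 0))))) :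
    ∃ s, IsNode m (σ ++ [s]) := by
  have hcmp : ∀ (τ : List Gen) (x y : Word), y 0 = 1 →
      FLeG m (loList τ x) (hiList τ y) ∨ GLeF m (loList τ x) (hiList τ y) :=
    fun τ _ _ hy => fLeG_or_gLeF hm _ (hiList_head τ hy)
  rcases hcmp (σ ++ [Gen.L]) (cons 0 (const 1)) (const 1) rfl with hL | hL
  swap
  · refine ⟨.L, ?_, hL⟩
    rw [loList_append_L, hiList_append_L]
    exact h.1
  rcases hcmp (σ ++ [Gen.M]) (const 0) (cons 1 (const 0)) rfl with hM | hM
  swap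
  · exact absurd (And.intro hL hM) h1
  rcases hcmp (σ ++ [Gen.M]) (cons 0 (const 1)) (const 1) rfl with hM' | hM'
  swap
  · exact ⟨.M, hM, hM'⟩
  rcases hcmp (σ ++ [Gen.R]) (const 0) (cons 1 (const 0)) rfl with hR | hR
  swap
  · exact absurd (And.intro hM' hR) h2
  refine ⟨.R, hR, ?_⟩
  rw [loList_append_R, hiList_append_R]
  exact h.2

theorem pre_add_of_const {s : ℕ → Gen} {t : Gen} {k : ℕ} (h : ∀ n, k ≤ n → s n = t) (j : ℕ) :
    pre s (k + j) = pre s k ++ List.replicate j t := by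
  induction j with
  | zero => simp
  | succ j ih =>
    rw [← add_assoc, pre_succ, ih, h _ (by omega), List.replicate_succ', List.append_assoc]

/-- If a sequence of substitutions with nested intervals containing `m` ends with `L L L ⋯`, then
`m` is the left end of one of these intervals. -/
theorem gLeF_of_eventually_L {m : ℝ} (hm : 1 < m) {s : ℕ → Gen} (hs : ∀ n, IsNode m (pre s n))
    {k : ℕ} (h : ∀ n, k ≤ n → s n = .L) :
    GLeF m (loList (pre s k) (const 0)) (hiList (pre s k) (cons 1 (const 0))) := by
  refine GLeF.of_approx hm (hiList_head _ rfl) fun N => ?_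
  have hn := (hs (k + N)).2
  have := agree_replicate .L rfl rfl lo_L_const_zero hi_L_one_zero (pre s k) N
    (x := cons 0 (const 1)) (y := const 1) rfl rfl
  rw [← pre_add_of_const h] at this
  exact ⟨_, _, this.1.mono (by omega), this.2.mono (by omega), hn⟩

/-- If a sequence of substitutions with nested intervals containing `m` ends with `R R R ⋯`, then
`m` is the right end of one of these intervals. -/
theorem fLeG_of_eventually_R {m : ℝ} (hm : 1 < m) {s : ℕ → Gen} (hs : ∀ n, IsNode m (pre s n))
    {k : ℕ} (h : ∀ n, k ≤ n → s n = .R) :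
    FLeG m (loList (pre s k) (cons 0 (const 1))) (hiList (pre s k) (const 1)) := by
  refine FLeG.of_approx hm fun N => ?_
  have hn := (hs (k + N)).1
  have := agree_replicate .R rfl rfl lo_R_zero_one hi_R_const_one (pre s k) N
    (x := const 0) (y := cons 1 (const 0)) rfl rfl
  rw [← pre_add_of_const h] at this
  exact ⟨_, _, this.1.mono (by omega), this.2.mono (by omega), hn⟩

/-- A minimal position from which on a sequence is constant. -/
theorem exists_pre_of_eventually {s : ℕ → Gen} {t : Gen} (h : ∃ k, ∀ n, k ≤ n → s n = t) :
    ∃ k, (∀ n, k ≤ n → s n = t) ∧ (k = 0 ∨ ∃ j, k = j + 1 ∧ s j ≠ t) := by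
  classical
  refine ⟨Nat.find h, Nat.find_spec h, ?_⟩
  rcases Nat.eq_zero_or_pos (Nat.find h) with h0 | h0
  · exact Or.inl h0
  refine Or.inr ⟨Nat.find h - 1, by omega, fun e => ?_⟩
  refine Nat.find_min h (m := Nat.find h - 1) (by omega) fun n hn => ?_
  rcases hn.eq_or_lt with e' | e'
  · rw [← e', e]
  · exact Nat.find_spec h n (by omega)

theorem cover {m : ℝ} (hm : 1 < m) (hm2 : m ≤ 2) :
    (∃ τ : List Gen, m ∈ Set.Icc (mu (listOnWord (τ ++ [Gen.M]) (evConst [1] 0)))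
        (mu (listOnWord (τ ++ [Gen.M]) (evConst [0, 1] 0)))) ∨
      (∃ τ : List Gen, m ∈ Set.Icc (mu (listOnWord (τ ++ [Gen.M]) (evConst [1, 0] 1)))
        (mu (listOnWord (τ ++ [Gen.M]) (evConst [0] 1)))) ∨
      m ∈ Set.Icc (mu (evConst [0] 1)) 2 ∨ ∃ u ∈ tmsWords, m = mu u := by
  by_contra! hc
  obtain ⟨h1, h2, h3, h4⟩ := hc
  replace h1 : ∀ τ : List Gen,
      ¬(FLeG m (loList (τ ++ [Gen.L]) (cons 0 (const 1))) (hiList (τ ++ [Gen.L]) (const 1)) ∧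
        GLeF m (loList (τ ++ [Gen.M]) (const 0)) (hiList (τ ++ [Gen.M]) (cons 1 (const 0)))) := by
    rintro τ ⟨h, h'⟩
    exact h1 τ ⟨((extremal_left_start τ).mu_le_iff (twoOnes_append_M _ _)).2 h,
      ((extremal_left_end τ).le_mu_iff (twoOnes_append_M _ _)).2 h'⟩
  replace h2 : ∀ τ : List Gen,
      ¬(FLeG m (loList (τ ++ [Gen.M]) (cons 0 (const 1))) (hiList (τ ++ [Gen.M]) (const 1)) ∧
        GLeF m (loList (τ ++ [Gen.R]) (const 0)) (hiList (τ ++ [Gen.R]) (cons 1 (const 0)))) := by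
    rintro τ ⟨h, h'⟩
    exact h2 τ ⟨((extremal_right_start τ).mu_le_iff (twoOnes_append_M _ _)).2 h,
      ((extremal_right_end τ).le_mu_iff (twoOnes_append_M _ _)).2 h'⟩
  replace h3 : ¬FLeG m (cons 0 (const 1)) (const 1) :=
    fun h => h3 ⟨mu_zero_ones_le_iff.2 h, hm2⟩
  have hroot : IsNode m [] := by
    refine ⟨fun y hy hF => ?_, (fLeG_or_gLeF hm _ rfl).resolve_left h3⟩
    rw [hiList_nil, F_one_zero (by linarith)] at hF
    linarith
  have hstep : ∀ σ, IsNode m σ → ∃ s, IsNode m (σ ++ [s]) := fun σ hσ =>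
    hσ.exists_child hm (h1 σ) (h2 σ)
  have : Nonempty Gen := ⟨.L⟩
  choose! next hnext using hstep
  let w : ℕ → List Gen := fun n => (fun σ => σ ++ [next σ])^[n] []
  have hw : ∀ n, w (n + 1) = w n ++ [next (w n)] := fun n => Function.iterate_succ_apply' _ _ _
  let s : ℕ → Gen := fun n => next (w n)
  have hpre : ∀ n, pre s n = w n := by
    intro n
    induction n with
    | zero => rfl
    | succ n ih => rw [pre_succ, ih, hw]
  have hs : ∀ n, IsNode m (pre s n) := by
    intro n
    rw [hpre]
    induction n with
    | zero => exact hroot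
    | succ n ih => rw [hw]; exact hnext _ ih
  by_cases hprim : IsPrimitive s
  · obtain ⟨u, hu⟩ := exists_limitWord s
    have htwo := hprim.twoOnes hu
    have hab := hprim.infO_le_tail hu
    refine h4 u ⟨s, hprim, hu⟩ (le_antisymm ((le_mu_iff htwo hab).2 ?_)
      ((mu_le_iff htwo hab).2 ?_))
    · refine GLeF.of_approx hm (hprim.supO_head hu) fun N => ?_
      obtain ⟨h5, h6, -⟩ := hprim.agree hu N (x := cons 0 (const 1)) (y := const 1) rfl rfl
      exact ⟨_, _, h5.mono (by omega), h6.mono (by omega), (hs N).2⟩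
    · refine FLeG.of_approx hm fun N => ?_
      obtain ⟨h5, h6, -⟩ := hprim.agree hu N (x := const 0) (y := cons 1 (const 0)) rfl rfl
      exact ⟨_, _, h5.mono (by omega), h6.mono (by omega), (hs N).1⟩
  obtain ⟨k, hk | hk⟩ := eventually_of_not_isPrimitive hprim
  · obtain ⟨k, hk, hj⟩ := exists_pre_of_eventually ⟨k, hk⟩
    have hge := gLeF_of_eventually_L hm hs hk
    have hle := (hs k).1
    rcases hj with rfl | ⟨j, rfl, hj⟩
    · have h5 := hge 2 le_rfl (by
        have h0 := wval_nonneg (x := 2) (by norm_num) (const 0)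
        have h1 := F_one_zero (y := 2) (by norm_num)
        rw [F_eq (by norm_num) rfl, drop_one_cons] at h1
        rw [show pre s 0 = [] from rfl, loList_nil, H]
        linarith)
      rw [show pre s 0 = [] from rfl, hiList_nil, F_one_zero (by norm_num)] at h5
      linarith
    · rw [pre_succ] at hge hle
      cases hsj : s j with
      | L => exact hj hsj
      | M =>
        rw [hsj] at hge hle
        exact h1 _ ⟨hle.mono (congrArg toLex (loList_left _)).le (hiList_left_le _), hge⟩
      | R =>
        rw [hsj] at hge hle
        exact h2 _ ⟨hle.mono (loList_right_le _) (congrArg toLex (hiList_right _)).le, hge⟩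
  · obtain ⟨k, hk, hj⟩ := exists_pre_of_eventually ⟨k, hk⟩
    have hle := fLeG_of_eventually_R hm hs hk
    have hge := (hs k).2
    rcases hj with rfl | ⟨j, rfl, hj⟩
    · exact h3 hle
    · rw [pre_succ] at hge hle
      cases hsj : s j with
      | L =>
        rw [hsj] at hge hle
        exact h1 _ ⟨hle, hge.mono (congrArg toLex (loList_left _)).le (hiList_left_le _)⟩
      | M =>
        rw [hsj] at hge hle
        exact h2 _ ⟨hle, hge.mono (loList_right_le _) (congrArg toLex (hiList_right _)).le⟩
      | R => exact hj hsj

theorem dimH_pos_of_critBase_lt {m : ℝ} (hm : 1 < m) (hm2 : m ≤ 2) {β : ℝ}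
    (hβ : critBase m < β) : 0 < dimH (val β '' uniqueExp β {0, 1, m}) := by
  have key : 0 < dimH (val β '' (uniqueExp β {0, 1, m} ∩ seqs {0, 1})) := by
    rcases cover hm hm2 with ⟨τ, h⟩ | ⟨τ, h⟩ | h | ⟨u, hu, rfl⟩
    · exact (critBase_left hm hm2 τ h).2 β hβ
    · exact (critBase_right hm hm2 τ h).2 β hβ
    · exact (critBase_zero_ones hm hm2 h.1).2 β hβ
    · exact (critBase_tms hu).2 β hβ
  exact key.trans_le (dimH_mono (Set.image_mono Set.inter_subset_left))

end TMS

theorem theorem1 :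
    -- `f_u`, `g_u` and `μ_u` are well defined
    (∀ u : TMS.Word,
      (∀ m : ℝ, 1 < m → m ≤ 2 → ∃! x : ℝ, TMS.IsG u m x) ∧
      (TMS.TwoOnes u →
        (∀ m : ℝ, 1 < m → m ≤ 2 → ∃! x : ℝ, TMS.IsF u m x) ∧ ∃! m : ℝ, TMS.IsMu u m)) ∧
    ∀ m : ℝ, 1 < m → m ≤ 2 →
      -- the formula in the four cases, where `σ = τ M` with `τ` a product of `L`, `M`, `R`
      (∀ τ : List TMS.Gen,
        m ∈ Set.Icc (TMS.mu (TMS.listOnWord (τ ++ [.M]) (TMS.evConst [1] 0)))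
            (TMS.mu (TMS.listOnWord (τ ++ [.M]) (TMS.evConst [0, 1] 0))) →
          TMS.critBase m = TMS.g (TMS.listOnWord (τ ++ [.M]) (TMS.evConst [1] 0)) m) ∧
      (∀ τ : List TMS.Gen,
        m ∈ Set.Icc (TMS.mu (TMS.listOnWord (τ ++ [.M]) (TMS.evConst [1, 0] 1)))
            (TMS.mu (TMS.listOnWord (τ ++ [.M]) (TMS.evConst [0] 1))) →
          TMS.critBase m = TMS.f (TMS.listOnWord (τ ++ [.M]) (TMS.evConst [0] 1)) m) ∧
      (m ∈ Set.Icc (TMS.mu (TMS.evConst [0] 1)) 2 →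
        TMS.critBase m = TMS.g (TMS.evConst [0] 1) m) ∧
      (∀ u ∈ TMS.tmsWords, m = TMS.mu u → TMS.critBase m = TMS.f u m) ∧
      -- the four cases cover the whole interval `(1, 2]`
      ((∃ τ : List TMS.Gen,
          m ∈ Set.Icc (TMS.mu (TMS.listOnWord (τ ++ [.M]) (TMS.evConst [1] 0)))
            (TMS.mu (TMS.listOnWord (τ ++ [.M]) (TMS.evConst [0, 1] 0)))) ∨
        (∃ τ : List TMS.Gen,
          m ∈ Set.Icc (TMS.mu (TMS.listOnWord (τ ++ [.M]) (TMS.evConst [1, 0] 1)))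
            (TMS.mu (TMS.listOnWord (τ ++ [.M]) (TMS.evConst [0] 1)))) ∨
        m ∈ Set.Icc (TMS.mu (TMS.evConst [0] 1)) 2 ∨
        ∃ u ∈ TMS.tmsWords, m = TMS.mu u) ∧
      -- positive Hausdorff dimension above the critical base
      ∀ β : ℝ, TMS.critBase m < β →
        0 < dimH (TMS.val β '' TMS.uniqueExp β {0, 1, m}) := by
  refine ⟨fun u => ⟨fun m hm _ => TMS.existsUnique_isG u hm, fun hu =>
    ⟨fun m hm hm2 => TMS.existsUnique_isF hu hm hm2, TMS.existsUnique_isMu hu⟩⟩,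
    fun m hm hm2 => ⟨fun τ h => (TMS.critBase_left hm hm2 τ h).1,
      fun τ h => (TMS.critBase_right hm hm2 τ h).1,
      fun h => (TMS.critBase_zero_ones hm hm2 h.1).1, ?_, TMS.cover hm hm2,
      fun β hβ => TMS.dimH_pos_of_critBase_lt hm hm2 hβ⟩⟩
  rintro u hu rfl
  exact (TMS.critBase_tms hu).1
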